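/- **Setting.** Let $N,K_c\ge 1$ and $X,T,X_\Delta\ge 0$ be integers, and put $$S_r^{\rm thresh}=N-(K_c+X+T-1),\qquad S_w^{\rm thresh}=X-(X_\Delta+T-1),\qquad \mu=\max(S_r^{\rm thresh},S_w^{\rm thresh}).$$ For each time $t=1,2,\dots$ let $\mathcal S_r^{(t)},\mathcal S_w^{(t)}\subseteq[N]$ be arbitrary sets (the servers unavailable in the read phase, respectively in the write phase) with $|\mathcal S_r^{(t)}|<S_r^{\rm thresh}$ and $|\mathcal S_w^{(t)}|<S_w^{\rm thresh}$, and put $R_r^{(t)}=S_r^{\rm thresh}-|\mathcal S_r^{(t)}|$, $R_w^{(t)}=S_w^{\rm thresh}-|\mathcal S_w^{(t)}|$. For integers $K,\xi\ge1$ let $J=\xi\cdot\mathrm{lcm}\{1,\dots,\mu\}$ and $L=JK_c$. There are $K$ submodels $W_k^{(t)}\in\mathbb F_q^L$; write $W_k(j,i)$ for the entry number $i+K_c(j-1)$, $j\in[J]$, $i\in[K_c]$, and similarly $\Delta(j,i)$ for a vector $\Delta\in\mathbb F_q^L$. At time $t$ a user with desired index $\theta_t\in[K]$ first retrieves $W^{(t-1)}_{\theta_t}$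 and then adds an increment $\Delta_t\in\mathbb F_q^L$ to it: $W^{(t)}_{\theta_t}=W^{(t-1)}_{\theta_t}+\Delta_t$ and $W_k^{(t)}=W_k^{(t-1)}$ for $k\ne\theta_t$. The initial submodels, each $\theta_t$, each $\Delta_t$, the storage noise and the noise of each user are uniform; the five families (initial submodels, increments, indices, user noise, storage noise) are mutually independent, and the noise of different users is independent. $H$ and $I$ denote Shannon entropy and mutual information in $q$-ary units. **The ACSA-RW scheme.** Let $\alpha_1,\dots,\alpha_N,\tilde f_1,\dots,\tilde f_{\max(\mu,K_c)}$ be distinct elements of $\mathbb F_q$. If $K_c\le\mu$, let $F$ consist of the first $K_c$ columns of the circulant $\mu\times\mu$ matrix with first column $(\tilde f_1,\dots,\tilde f_\mu)$; if $\mu<K_c$, let $F$ consist of the first $\mu$ rows of the circulant $K_c\times K_c$ matrix with first row $(\tilde f_1,\dots,\tilde f_{K_c})$. Let $f_{j,i}$ be the entries of the $J\times K_c$ matrix that repeats $F$ vertically $J/\mu$ times. * *Storage.* Server $n$ holds vectors $S_{n,j}^{(t)}\in\mathbb F_q^K$, $j\in[J]$, with initially $S_{n,j}^{(0)}=\sum_{i}\frac{1}{\alpha_n-f_{j,i}}\big(W_k^{(0)}(j,i)\big)_{k\in[K]}+\sum_{x=1}^{X}\alpha_n^{x-1}Z_{j,x}$,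 where the $Z_{j,x}\in\mathbb F_q^K$ are the storage noise. * *Read.* The read query of server $n$ is $Q_{n,j,i}=e_{\theta_t}+(\alpha_n-f_{j,i})\sum_{s=1}^{T}\alpha_n^{s-1}\tilde Z_{u,i,s}$, $j\in[J]$, $i\in[K_c]$, where $u\in[\mu]$, $u\equiv j\pmod\mu$, and the $\tilde Z_{u,i,s}\in\mathbb F_q^K$ are fresh noise. Only the rows $j\in[\mu]$, i.e. $\mu K_cK$ symbols, are sent; they determine the others. An available server answers, for each of the $J/R_r^{(t)}$ blocks $B$ of $R_r^{(t)}$ consecutive rows and each $i\in[K_c]$, with the symbol $$\sum_{j\in B}\prod_{i'\ne i}\frac{\alpha_n-f_{j,i'}}{f_{j,i}-f_{j,i'}}\,\big(S_{n,j}^{(t-1)}\big)^{\mathsf T}Q_{n,j,i}.$$ * *Write.* For each of the $J/R_w^{(t)}$ blocks $B$ of $R_w^{(t)}$ consecutive rows and each $i\in[K_c]$ the write query of a server $n\notin\mathcal S_w^{(t)}$ contains the symbol $P_{n,B,i}=\sum_{j\in B}\frac{\Delta_t(j,i)}{\alpha_n-f_{j,i}}+\sum_{x=1}^{X_\Delta}\alpha_n^{x-1}Z'_{B,i,x}$,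 with fresh scalar noise $Z'_{B,i,x}\in\mathbb F_q$; for $n\in\mathcal S_w^{(t)}$ the write query is null. A server $n\notin\mathcal S_w^{(t)}$ then sets, with $B(j)$ the block containing $j$, $$S_{n,j}^{(t)}=S_{n,j}^{(t-1)}+\sum_{i\in[K_c]}\ \prod_{m\in\mathcal S_w^{(t)}}\frac{\alpha_n-\alpha_m}{f_{j,i}-\alpha_m}\ \prod_{j'\in B(j)\setminus\{j\}}\frac{\alpha_n-f_{j',i}}{f_{j,i}-f_{j',i}}\ P_{n,B(j),i}\,Q_{n,j,i}.$$ The download cost $D_t$ (upload cost $U_t$) is the number of $q$-ary symbols downloaded (uploaded) by the user at time $t$, divided by $L$. Read queries are sent to all servers available in at least one phase, write queries to those available in the write phase. The storage efficiency is $\eta^{(t)}=KL/\sum_nH(S_n^{(t)})$. **Theorem.** Let $q\ge N+\max(S_r^{\rm thresh},S_w^{\rm thresh},K_c)$. Then constants $\alpha_n,\tilde f_m$ as required exist, and for every choice of them the ACSA-RW scheme has the following properties. 1. *Costs.* For all $t\ge1$ $$D_t=\frac{N-|\mathcal S_r^{(t)}|}{S_r^{\rm thresh}-|\mathcal S_r^{(t)}|},\qquad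 \lim_{L/K\to\infty}U_t=\frac{N-|\mathcal S_w^{(t)}|}{S_w^{\rm thresh}-|\mathcal S_w^{(t)}|},$$ and $\eta^{(t)}=K_c/N$ for all $t\ge0$. 2. *Correctness.* $H\big(W^{(t-1)}_{\theta_t}\mid (A_n^{(t)})_{n\notin\mathcal S_r^{(t)}},(Q_n^{(t)})_{n\in[N]},\theta_t\big)=0$ for all $t\ge1$, where $A_n^{(t)}$ is the answer of server $n$. 3. *$T$-privacy.* $I\big((\theta_\tau)_{\tau\le t};(P_n^{(t)},Q_n^{(t)})_{n\in\mathcal T}\mid (S_n^{(\tau-1)})_{\tau\le t,\,n\in\mathcal T},(P_n^{(\tau)},Q_n^{(\tau)})_{\tau<t,\,n\in\mathcal T}\big)=0$ for all $t\ge 1$ and $\mathcal T\subseteq[N]$ with $|\mathcal T|\le T$. 4. *$X_\Delta$-security.* $I\big((\Delta_\tau)_{\tau\le t};(P_n^{(t)})_{n\in\mathcal X}\mid (S_n^{(\tau-1)},Q_n^{(\tau)})_{\tau\le t,\,n\in\mathcal X},(P_n^{(\tau)})_{\tau<t,\,n\in\mathcal X}\big)=0$ for all $t\ge1$ and $\mathcal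 X\subseteq[N]$ with $|\mathcal X|\le X_\Delta$. 5. *$X$-security.* $I\big((W_k^{(t)})_{k\in[K]};(S_n^{(t)})_{n\in\mathcal X}\big)=0$ for all $t\ge0$ and $\mathcal X\subseteq[N]$ with $|\mathcal X|\le X$. 6. *Storage structure.* For every $t\ge0$ there are random vectors $Z^{(t)}_{j,x}\in\mathbb F_q^K$, jointly uniform and independent of $(W_k^{(t)})_k$, such that $S_{n,j}^{(t)}=\sum_i\frac1{\alpha_n-f_{j,i}}\big(W_k^{(t)}(j,i)\big)_k+\sum_{x=1}^X\alpha_n^{x-1}Z^{(t)}_{j,x}$ for all $n\in[N]$, $j\in[J]$; moreover $S_n^{(t)}=S_n^{(t-1)}$ for $t\ge1$ and $n\in\mathcal S_w^{(t)}$. -/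

import Mathlib

namespace ACSA

open MeasureTheory ProbabilityTheory

/-! ### Shannon information of finite-valued random variables, in `q`-ary units -/

/-- Entropy `H(A)` of a random variable with a finite alphabet, in `q`-ary units. -/
noncomputable def entropy {Ω α : Type*} [MeasurableSpace Ω] [Fintype α] (q : ℕ)
    (P : Measure Ω) (A : Ω → α) : ℝ :=
  (∑ a, Real.negMulLog (P.real (A ⁻¹' {a}))) / Real.log q

/-- Conditional entropy `H(A | B) = H(A, B) - H(B)`. -/
noncomputable def condEntropy {Ω α β : Type*} [MeasurableSpace Ω] [Fintype α] [Fintype β] (q : ℕ)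
    (P : Measure Ω) (A : Ω → α) (B : Ω → β) : ℝ :=
  entropy q P (fun ω => (A ω, B ω)) - entropy q P B

/-- Mutual information `I(A ; B) = H(A) + H(B) - H(A, B)`. -/
noncomputable def mutualInfo {Ω α β : Type*} [MeasurableSpace Ω] [Fintype α] [Fintype β] (q : ℕ)
    (P : Measure Ω) (A : Ω → α) (B : Ω → β) : ℝ :=
  entropy q P A + entropy q P B - entropy q P (fun ω => (A ω, B ω))

/-- Conditional mutual information
`I(A ; B | C) = H(A, C) + H(B, C) - H(A, B, C) - H(C)`. -/
noncomputable def condMutualInfo {Ω α β γ : Type*} [MeasurableSpace Ω] [Fintype α] [Fintype β]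
    [Fintype γ] (q : ℕ) (P : Measure Ω) (A : Ω → α) (B : Ω → β) (C : Ω → γ) : ℝ :=
  entropy q P (fun ω => (A ω, C ω)) + entropy q P (fun ω => (B ω, C ω))
    - entropy q P (fun ω => (A ω, B ω, C ω)) - entropy q P C

/-- `A` is a random variable that is uniformly distributed on its finite alphabet. -/
def IsUniform {Ω α : Type*} [MeasurableSpace Ω] [MeasurableSpace α] (A : Ω → α)
    (P : Measure Ω) : Prop :=
  Measurable A ∧ P.map A = uniformOn Set.univ

/-- The number of `q`-ary symbols in a fixed-length message with alphabet `α`,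
that is `log_q |α|`; it is `m` for messages in `F ^ m` with `|F| = q`. -/
noncomputable def symbolCount (q : ℕ) (α : Type*) [Fintype α] : ℝ :=
  Real.logb q (Fintype.card α)

/-! ### Parameters -/

/-- The read-dropout threshold `N - (Kc + X + T - 1)`
(truncated at `0`, written without a subtraction inside). -/
def readThresh (N Kc X T : ℕ) : ℕ := N + 1 - (Kc + X + T)

/-- The write-dropout threshold `X - (XΔ + T - 1)`
(truncated at `0`, written without a subtraction inside). -/
def writeThresh (X XΔ T : ℕ) : ℕ := X + 1 - (XΔ + T)

/-- Number of servers `N`, coding parameter `Kc`, security and privacy levels `X`, `T`, `XΔ`, and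
the sets of servers that drop out in the read phase and in the write phase of each time slot.
Time slots are numbered `0, 1, 2, …`. -/
structure Params where
  N : ℕ
  Kc : ℕ
  X : ℕ
  T : ℕ
  XΔ : ℕ
  Sr : ℕ → Finset (Fin N)
  Sw : ℕ → Finset (Fin N)
  Kc_pos : 0 < Kc
  card_Sr_lt : ∀ t, (Sr t).card < readThresh N Kc X T
  card_Sw_lt : ∀ t, (Sw t).card < writeThresh X XΔ T

namespace Params

variable (p : Params)

def SrThresh : ℕ := readThresh p.N p.Kc p.X p.T

def SwThresh : ℕ := writeThresh p.X p.XΔ p.T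

/-- `μ`, the maximum of the two thresholds. -/
def mu : ℕ := max p.SrThresh p.SwThresh

/-- The length `J` of the columns into which the symbols of a submodel are arranged;
`ξ` is the free scaling parameter. -/
def J (ξ : ℕ) : ℕ :=
  ξ * (Finset.Icc 1 p.SrThresh ∪ Finset.Icc 1 p.SwThresh).lcm id

/-- The size `L` of a submodel. -/
def L (ξ : ℕ) : ℕ := p.J ξ * p.Kc

/-- Number of symbols retrieved in a read sub-operation at time `t`. -/
def Rr (t : ℕ) : ℕ := p.SrThresh - (p.Sr t).card

/-- Number of symbols updated in a write sub-operation at time `t`. -/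
def Rw (t : ℕ) : ℕ := p.SwThresh - (p.Sw t).card

/-- Number of blocks of rows in the read phase at time `t`. -/
def numR (ξ t : ℕ) : ℕ := p.J ξ / p.Rr t

/-- Number of blocks of rows in the write phase at time `t`. -/
def numW (ξ t : ℕ) : ℕ := p.J ξ / p.Rw t

theorem mu_pos : 0 < p.mu :=
  lt_of_lt_of_le (lt_of_le_of_lt (Nat.zero_le _) (p.card_Sr_lt 0)) (le_max_left _ _)

theorem Rw_pos (t : ℕ) : 0 < p.Rw t := Nat.sub_pos_of_lt (p.card_Sw_lt t)

theorem Rr_pos (t : ℕ) : 0 < p.Rr t := Nat.sub_pos_of_lt (p.card_Sr_lt t)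

theorem Rr_dvd_J (ξ t : ℕ) : p.Rr t ∣ p.J ξ := by
  refine Dvd.dvd.mul_left ?_ ξ
  have h : p.Rr t ∈ Finset.Icc 1 p.SrThresh ∪ Finset.Icc 1 p.SwThresh :=
    Finset.mem_union_left _ (Finset.mem_Icc.2 ⟨p.Rr_pos t, Nat.sub_le _ _⟩)
  exact Finset.dvd_lcm (f := id) h

theorem Rw_dvd_J (ξ t : ℕ) : p.Rw t ∣ p.J ξ := by
  refine Dvd.dvd.mul_left ?_ ξ
  have h : p.Rw t ∈ Finset.Icc 1 p.SrThresh ∪ Finset.Icc 1 p.SwThresh :=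
    Finset.mem_union_right _ (Finset.mem_Icc.2 ⟨p.Rw_pos t, Nat.sub_le _ _⟩)
  exact Finset.dvd_lcm (f := id) h

/-- The block of `Rr t` consecutive rows that contains row `j`. -/
def blockR {ξ : ℕ} (t : ℕ) (j : Fin (p.J ξ)) : Fin (p.numR ξ t) :=
  ⟨j / p.Rr t, Nat.div_lt_div_of_lt_of_dvd (p.Rr_dvd_J ξ t) j.2⟩

/-- The block of `Rw t` consecutive rows that contains row `j`. -/
def blockW {ξ : ℕ} (t : ℕ) (j : Fin (p.J ξ)) : Fin (p.numW ξ t) :=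
  ⟨j / p.Rw t, Nat.div_lt_div_of_lt_of_dvd (p.Rw_dvd_J ξ t) j.2⟩

/-- The position of row `j` in its period of length `μ`. -/
def row {ξ : ℕ} (j : Fin (p.J ξ)) : Fin p.mu := ⟨j % p.mu, Nat.mod_lt _ p.mu_pos⟩

/-- Which of the constants `f̃` stands in position `(r, c)` of the `μ × Kc` matrix of poles:
the first `Kc` columns of a circulant `μ × μ` matrix with first column `f̃` if `Kc ≤ μ`,
the first `μ` rows of a circulant `Kc × Kc` matrix with first row `f̃` if `μ < Kc`. -/
def poleIdx (r : Fin p.mu) (c : Fin p.Kc) : Fin (max p.mu p.Kc) :=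
  ⟨if p.Kc ≤ p.mu then (r + (max p.mu p.Kc) - c) % (max p.mu p.Kc)
    else (c + (max p.mu p.Kc) - r) % (max p.mu p.Kc), by
    have h : 0 < max p.mu p.Kc := lt_of_lt_of_le p.mu_pos (le_max_left _ _)
    split_ifs <;> exact Nat.mod_lt _ h⟩

end Params

/-- The `N + max (μ, Kc)` distinct constants `α₁, …, α_N, f̃₁, f̃₂, …` of the field. -/
structure Constants (p : Params) (F : Type*) where
  α : Fin p.N → F
  ft : Fin (max p.mu p.Kc) → F
  distinct : Function.Injective (Sum.elim α ft)

/-! ### Alphabets -/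

section Alphabets

variable (p : Params) (F : Type*) (K ξ : ℕ)

/-- `K` submodels of `L` symbols each. -/
abbrev Submodels := Fin K → Fin (p.L ξ) → F

/-- The content of one server: `J` blocks of `K` symbols. -/
abbrev Storage := Fin (p.J ξ) → Fin K → F

/-- The storage noise: vectors of length `K` indexed by `j ∈ [J]`, `x ∈ [X]`. -/
abbrev StorageNoise := Fin (p.J ξ) → Fin p.X → Fin K → F

/-- User-side noise of the read query: vectors of length `K` indexed by `[μ] × [Kc] × [T]`. -/
abbrev ReadNoise := Fin p.mu → Fin p.Kc → Fin p.T → Fin K → F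

/-- User-side noise of the write query: scalars indexed by `[numW] × [Kc] × [XΔ]`. -/
abbrev WriteNoise (t : ℕ) := Fin (p.numW ξ t) → Fin p.Kc → Fin p.XΔ → F

/-- The private randomness of the user at time `t`. -/
abbrev UserNoise (t : ℕ) := ReadNoise p F K × WriteNoise p F ξ t

/-- A read query for one server: `Kc` vectors of length `J K`. -/
abbrev ReadQuery := Fin (p.J ξ) → Fin p.Kc → Fin K → F

/-- What is sent over the network to convey a read query: its first `μ` rows. -/
abbrev ReadMessage := Fin p.mu → Fin p.Kc → Fin K → F

/-- A write query for one server. -/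
abbrev WriteQuery (t : ℕ) := Fin (p.numW ξ t) → Fin p.Kc → F

/-- The answer of one server at time `t`. -/
abbrev Answer (t : ℕ) := Fin (p.numR ξ t) → Fin p.Kc → F

end Alphabets

/-! ### The scheme -/

section Scheme

variable {p : Params} {F : Type*} [Field F] {K ξ : ℕ} (c : Constants p F)

/-- The poles `f_{j,i}`. -/
def pole (j : Fin (p.J ξ)) (i : Fin p.Kc) : F := c.ft (p.poleIdx (p.row j) i)

/-- The symbol `W_k(j, i)`, i.e. symbol number `i + Kc j` (from `0`) of the submodel. -/
def entry (w : Fin (p.L ξ) → F) (j : Fin (p.J ξ)) (i : Fin p.Kc) : F :=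
  w (finProdFinEquiv (j, i))

/-- The storage of server `n` that encodes the submodels `W` with the noise `Z`. -/
def acsaStorage (n : Fin p.N) (W : Submodels p F K ξ) (Z : StorageNoise p F K ξ) :
    Storage p F K ξ := fun j k =>
  ∑ i, 1 / (c.α n - pole c j i) * entry (W k) j i + ∑ x : Fin p.X, c.α n ^ (x : ℕ) * Z j x k

/-- The read query for server `n` of a user who wants submodel `θ`. -/
def readQuery (n : Fin p.N) (θ : Fin K) (z : ReadNoise p F K) : ReadQuery p F K ξ := fun j i k =>
  (if k = θ then 1 else 0)
    + (c.α n - pole c j i) * ∑ s : Fin p.T, c.α n ^ (s : ℕ) * z (p.row j) i s k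

/-- The symbols that the user sends to server `n` in place of the whole read query. -/
def readMessage (n : Fin p.N) (θ : Fin K) (z : ReadNoise p F K) : ReadMessage p F K :=
  fun u i k =>
  (if k = θ then 1 else 0)
    + (c.α n - c.ft (p.poleIdx u i)) * ∑ s : Fin p.T, c.α n ^ (s : ℕ) * z u i s k

/-- The write query for server `n` with increment `d` at time `t`. -/
def writeQuery (t : ℕ) (n : Fin p.N) (d : Fin (p.L ξ) → F) (z : WriteNoise p F ξ t) :
    WriteQuery p F ξ t := fun l i =>
  ∑ j with p.blockW t j = l, 1 / (c.α n - pole c j i) * entry d j i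
    + ∑ x : Fin p.XΔ, c.α n ^ (x : ℕ) * z l i x

/-- Coefficient of the packer in row `j`. -/
def packer (n : Fin p.N) (i : Fin p.Kc) (j : Fin (p.J ξ)) : F :=
  (∏ i' ∈ Finset.univ.erase i, (c.α n - pole c j i'))
    / ∏ i' ∈ Finset.univ.erase i, (pole c j i - pole c j i')

/-- Coefficient of the unpacker in row `j`. -/
def unpacker (t : ℕ) (n : Fin p.N) (i : Fin p.Kc) (j : Fin (p.J ξ)) : F :=
  (∏ j' with p.blockW t j' = p.blockW t j ∧ j' ≠ j, (c.α n - pole c j' i))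
    / ∏ j' with p.blockW t j' = p.blockW t j ∧ j' ≠ j, (pole c j i - pole c j' i)

/-- Coefficient of the null-shaper in row `j`. -/
def nullShaper (t : ℕ) (n : Fin p.N) (i : Fin p.Kc) (j : Fin (p.J ξ)) : F :=
  (∏ m ∈ p.Sw t, (c.α n - c.α m)) / ∏ m ∈ p.Sw t, (pole c j i - c.α m)

/-- The answer of server `n` with storage `S` to the read query `Q`: symbol `(l, i)` is
computed from the `l`-th block of `Rr t` rows. -/
def answer (t : ℕ) (n : Fin p.N) (S : Storage p F K ξ) (Q : ReadQuery p F K ξ) :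
    Answer p F ξ t := fun l i =>
  ∑ j with p.blockR t j = l, ∑ k, S j k * (packer c n i j * Q j i k)

/-- The new storage of a server `n` that is available in the write phase. -/
def updateStorage (t : ℕ) (n : Fin p.N) (S : Storage p F K ξ) (P : WriteQuery p F ξ t)
    (Q : ReadQuery p F K ξ) : Storage p F K ξ := fun j k =>
  S j k + ∑ i, nullShaper c t n i j * unpacker c t n i j * P (p.blockW t j) i * Q j i k

end Scheme

/-! ### Communication costs -/

section Costs

variable (p : Params) (F : Type*) [Fintype F] (K ξ : ℕ)

/-- Symbols downloaded by the user at time `t` (one answer from each available server),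
normalized by `L`. All messages have fixed length. -/
noncomputable def downloadCost (t : ℕ) : ℝ :=
  (∑ _n ∈ (p.Sr t)ᶜ, symbolCount (Fintype.card F) (Answer p F ξ t)) / p.L ξ

/-- Symbols uploaded by the user at time `t`, normalized by `L`: the read query goes to every server
that is available in at least one of the two phases, the write query to every server that is
available in the write phase. -/
noncomputable def uploadCost (t : ℕ) : ℝ :=
  (∑ _n ∈ (p.Sr t ∩ p.Sw t)ᶜ, symbolCount (Fintype.card F) (ReadMessage p F K)
    + ∑ _n ∈ (p.Sw t)ᶜ, symbolCount (Fintype.card F) (WriteQuery p F ξ t)) / p.L ξ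

end Costs

/-! ### Probabilistic model -/

/-- The primitive random variables: initial submodels `W0`, storage noise `ZS`, desired indices
`idx t`, increments `inc t` and user-side noise `ZU t`. The five families are mutually independent
(each is independent of the joint value of those after it) and the noise of different users is
independent. -/
structure Model (p : Params) (F : Type*) (K ξ : ℕ) [MeasurableSpace F]
    {Ω : Type*} [MeasurableSpace Ω] (P : Measure Ω) where
  W0 : Ω → Submodels p F K ξ
  ZS : Ω → StorageNoise p F K ξ
  idx : ℕ → Ω → Fin K
  inc : ℕ → Ω → Fin (p.L ξ) → F
  ZU : (t : ℕ) → Ω → UserNoise p F K ξ t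
  unif_W0 : IsUniform W0 P
  unif_ZS : IsUniform ZS P
  unif_idx : ∀ t, IsUniform (idx t) P
  unif_inc : ∀ t, IsUniform (inc t) P
  unif_ZU : ∀ t, IsUniform (ZU t) P
  indep_ZU : iIndepFun ZU P
  indep₁ : IndepFun ZS
    (fun ω => ((fun t => ZU t ω), W0 ω, (fun t => inc t ω), (fun t => idx t ω))) P
  indep₂ : IndepFun (fun ω t => ZU t ω)
    (fun ω => (W0 ω, (fun t => inc t ω), (fun t => idx t ω))) P
  indep₃ : IndepFun W0 (fun ω => ((fun t => inc t ω), (fun t => idx t ω))) P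
  indep₄ : IndepFun (fun ω t => inc t ω) (fun ω t => idx t ω) P

namespace Model

variable {p : Params} {F : Type*} [Field F] [MeasurableSpace F] {K ξ : ℕ}
  {Ω : Type*} [MeasurableSpace Ω] {P : Measure Ω} (M : Model p F K ξ P) (c : Constants p F)

/-- The submodels after the updates of the users `0, …, t - 1`. -/
def W : ℕ → Ω → Submodels p F K ξ
  | 0, ω => M.W0 ω
  | t + 1, ω => fun k => if k = M.idx t ω then W t ω k + M.inc t ω else W t ω k

/-- The read query of user `t` for server `n`. -/
def Q (t : ℕ) (n : Fin p.N) (ω : Ω) : ReadQuery p F K ξ :=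
  readQuery c n (M.idx t ω) (M.ZU t ω).1

/-- The write query of user `t` for server `n`; null for write-dropout servers. -/
def PW (t : ℕ) (n : Fin p.N) (ω : Ω) : Option (WriteQuery p F ξ t) :=
  if n ∈ p.Sw t then none else some (writeQuery c t n (M.inc t ω) (M.ZU t ω).2)

/-- The storage of server `n` after the updates of the users `0, …, t - 1`. -/
def S : ℕ → Fin p.N → Ω → Storage p F K ξ
  | 0, n, ω => acsaStorage c n (M.W0 ω) (M.ZS ω)
  | t + 1, n, ω => match M.PW c t n ω with
    | none => S t n ω
    | some w => updateStorage c t n (S t n ω) w (M.Q c t n ω)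

/-- The answer of server `n` to user `t`. -/
def A (t : ℕ) (n : Fin p.N) (ω : Ω) : Answer p F ξ t :=
  answer c t n (M.S c t n ω) (M.Q c t n ω)

variable [Fintype F]

/-- Correctness at time `t`: the desired submodel is determined by the answers of the available
servers, the read queries and the desired index. -/
def Correct (t : ℕ) : Prop :=
  condEntropy (Fintype.card F) P (fun ω => M.W t ω (M.idx t ω))
    (fun ω => ((fun n : {n // n ∉ p.Sr t} => M.A c t n ω), (fun n => M.Q c t n ω), M.idx t ω)) = 0

set_option synthInstance.maxSize 1000 in
/-- The servers in `𝒯` learn nothing about the indices desired so far from the queries of user `t`,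
given everything that they have seen before. -/
def Private (t : ℕ) (𝒯 : Finset (Fin p.N)) : Prop :=
  condMutualInfo (Fintype.card F) P
    (fun ω (τ : Fin (t + 1)) => M.idx τ ω)
    (fun ω (n : 𝒯) => (M.PW c t n ω, M.Q c t n ω))
    (fun ω => ((fun (τ : Fin (t + 1)) (n : 𝒯) => M.S c τ n ω),
      (fun (τ : Fin t) (n : 𝒯) => M.PW c τ n ω), (fun (τ : Fin t) (n : 𝒯) => M.Q c τ n ω))) = 0

/-- The servers in `𝒳` learn nothing about the increments made so far from the write queries of user
`t`, given everything that they have seen before. -/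
def UpdateSecure (t : ℕ) (𝒳 : Finset (Fin p.N)) : Prop :=
  condMutualInfo (Fintype.card F) P
    (fun ω (τ : Fin (t + 1)) => M.inc τ ω)
    (fun ω (n : 𝒳) => M.PW c t n ω)
    (fun ω => ((fun (τ : Fin (t + 1)) (n : 𝒳) => (M.S c τ n ω, M.Q c τ n ω)),
      (fun (τ : Fin t) (n : 𝒳) => M.PW c τ n ω))) = 0

/-- The storage of the servers in `𝒳` reveals nothing about the current submodels. -/
def StorageSecure (t : ℕ) (𝒳 : Finset (Fin p.N)) : Prop :=
  mutualInfo (Fintype.card F) P (M.W t) (fun ω (n : 𝒳) => M.S c t n ω) = 0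

/-- The storage still encodes the current submodels: all servers together hold the code of
`W t` with some noise that is uniform and independent of `W t`. -/
def StructurePreserved (t : ℕ) : Prop :=
  ∃ Z : Ω → StorageNoise p F K ξ, IsUniform Z P ∧ IndepFun Z (M.W t) P ∧
    ∀ n ω, M.S c t n ω = acsaStorage c n (M.W t ω) (Z ω)

/-- Storage efficiency `K L / ∑ₙ H(Sₙ)` at time `t`. -/
noncomputable def efficiency (t : ℕ) : ℝ :=
  (K * p.L ξ : ℝ) / ∑ n, entropy (Fintype.card F) P (M.S c t n)

end Model

end ACSA

/-! ### Finite-valued random variables: independence, uniformity, entropy. -/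

namespace ACSA

open MeasureTheory ProbabilityTheory

/-! Every quantity handled by server `n` is the value at `α n` of a sum of simple fractions plus a
polynomial. The data are the residues, the noise is the polynomial. Multiplying by a polynomial
scales each residue by its value at the pole and only enlarges the polynomial part
(`exists_mul_simple_fractions`).

Reading: packer times query is 1 at the wanted pole for the wanted submodel, and 0 for other
submodels or at the other poles of the row. An answer therefore carries the desired symbols of one
block plus a polynomial with `Kc + X + T - 1` coefficients. Residues and coefficients together are
at most as many as the available servers, and Cauchy–Vandermonde independence recovers the residues
(`eq_of_answer_eq`).

Writing: null-shaper times unpacker times query isolates one row of the block, and the resulting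
polynomial part fits into `X` coefficients (`card_add_le_X`). The update thus adds a code word for
the increment (`exists_update_noise`), and the null-shaper vanishes at the servers that drop out. By
induction the storage always encodes the current submodels, with noise equal to the original storage
noise plus a function of increments, indices and user noise.

The probabilistic claims are one-time pads (`IsUniform.shift`). A small coalition sees noise
polynomials at few points, so by interpolation the secret is absorbed into a shift of the noise. The
whole view becomes a function of the shifted noise and of variables independent of the secret, and
the information vanishes. -/

/-- The hypothesis on pairs of outcomes says that `A` determines `B`, without naming the function;
on a countable discrete alphabet that function is measurable. -/
theorem measurable_of_factor {Ω α β : Type*} [MeasurableSpace Ω] [MeasurableSpace α]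
    [MeasurableSingletonClass α] [Countable α] [MeasurableSpace β] {A : Ω → α} {B : Ω → β} (hA : Measurable A)
    (h : ∀ ω ω', A ω = A ω' → B ω = B ω') : Measurable B := by
  cases isEmpty_or_nonempty Ω
  · exact Subsingleton.measurable
  have : Nonempty β := ⟨B (Classical.arbitrary Ω)⟩
  obtain ⟨g, rfl⟩ := (Function.factorsThrough_iff B (f := A)).1 fun ω ω' => h ω ω'
  exact (Measurable.of_discrete (f := g)).comp hA

theorem indepFun_of_factor {Ω α β γ : Type*} [MeasurableSpace Ω] {P : Measure Ω}
    [IsProbabilityMeasure P] [MeasurableSpace α] [MeasurableSpace β] [MeasurableSingletonClass β]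
    [Countable β] [MeasurableSpace γ] {A : Ω → α} {B : Ω → β} {C : Ω → γ} (hAB : IndepFun A B P)
    (h : ∀ ω ω', B ω = B ω' → C ω = C ω') : IndepFun A C P := by
  have : Nonempty Ω := nonempty_of_isProbabilityMeasure P
  have : Nonempty γ := ⟨C (Classical.arbitrary Ω)⟩
  obtain ⟨g, rfl⟩ := (Function.factorsThrough_iff C (f := B)).1 fun ω ω' => h ω ω'
  exact hAB.comp measurable_id (Measurable.of_discrete (f := g))

section Independence

variable {Ω : Type*} [MeasurableSpace Ω] {P : Measure Ω} [IsProbabilityMeasure P]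
  {α β γ : Type*} [MeasurableSpace α] [MeasurableSingletonClass α] [Countable α]
  [MeasurableSpace β] [MeasurableSingletonClass β] [Countable β]
  [MeasurableSpace γ] [MeasurableSingletonClass γ] [Countable γ]

/-- On countable alphabets atoms determine the joint law, here a product measure; its first marginal
identifies `ν`. -/
theorem map_eq_and_indepFun_of_singleton {A : Ω → α} {B : Ω → β} (hA : Measurable A)
    (hB : Measurable B) (ν : Measure α) [IsProbabilityMeasure ν]
    (h : ∀ a b, P (A ⁻¹' {a} ∩ B ⁻¹' {b}) = ν {a} * P (B ⁻¹' {b})) :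
    P.map A = ν ∧ IndepFun A B P := by
  have := Measure.isProbabilityMeasure_map (μ := P) hB.aemeasurable
  have hj : P.map (fun ω => (A ω, B ω)) = ν.prod (P.map B) := by
    refine Measure.ext_of_singleton ?_
    rintro ⟨a, b⟩
    rw [Measure.map_apply (hA.prodMk hB) (measurableSet_singleton _),
      ← Set.singleton_prod_singleton, Measure.prod_prod,
      Measure.map_apply hB (measurableSet_singleton _), ← h, Set.mk_preimage_prod]
  have hm : P.map A = ν := by
    have h1 : (P.map (fun ω => (A ω, B ω))).map Prod.fst = P.map A := by
      rw [Measure.map_map measurable_fst (hA.prodMk hB)]; rfl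
    rw [← h1, hj, Measure.map_fst_prod]
    simp
  refine ⟨hm, ?_⟩
  rw [indepFun_iff_map_prod_eq_prod_map_map hA.aemeasurable hB.aemeasurable, hj, hm]

theorem indepFun_of_singleton {A : Ω → α} {B : Ω → β} (hA : Measurable A)
    (hB : Measurable B)
    (h : ∀ a b, P (A ⁻¹' {a} ∩ B ⁻¹' {b}) = P (A ⁻¹' {a}) * P (B ⁻¹' {b})) :
    IndepFun A B P := by
  have := Measure.isProbabilityMeasure_map (μ := P) hA.aemeasurable
  refine (map_eq_and_indepFun_of_singleton hA hB (P.map A) fun a b => ?_).2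
  rw [h, Measure.map_apply hA (measurableSet_singleton _)]

/-- If `A` is independent of `(B, C)`, and `B` of `C`, then `B` is independent of `(A, C)`. -/
theorem indepFun_prod_rotate {A : Ω → α} {B : Ω → β} {C : Ω → γ} (hA : Measurable A)
    (hB : Measurable B) (hC : Measurable C) (h : IndepFun A (fun ω => (B ω, C ω)) P)
    (h' : IndepFun B C P) : IndepFun B (fun ω => (A ω, C ω)) P := by
  refine indepFun_of_singleton hB (hA.prodMk hC) ?_
  rintro b ⟨a, c⟩
  have hAC : IndepFun A C P := h.comp (φ := id) (ψ := Prod.snd) measurable_id measurable_snd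
  have e1 := h.measure_inter_preimage_eq_mul {a} {(b, c)} (measurableSet_singleton _)
    (measurableSet_singleton _)
  have e2 := h'.measure_inter_preimage_eq_mul {b} {c} (measurableSet_singleton _)
    (measurableSet_singleton _)
  have e3 := hAC.measure_inter_preimage_eq_mul {a} {c} (measurableSet_singleton _)
    (measurableSet_singleton _)
  -- Both sides become the product of the three marginal probabilities.
  rw [← Set.singleton_prod_singleton, Set.mk_preimage_prod] at e1 ⊢
  rw [e3, Set.inter_left_comm, e1, e2]
  ring

end Independence

/-! ### Uniform variables and the one-time pad. -/

section Uniform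

variable {Ω : Type*} [MeasurableSpace Ω] {P : Measure Ω}
  {α β γ : Type*} [MeasurableSpace α] [MeasurableSingletonClass α] [Fintype α]

theorem uniformOn_univ_singleton (a : α) :
    uniformOn (Set.univ : Set α) {a} = (Fintype.card α : ENNReal)⁻¹ := by
  rw [uniformOn_univ, Measure.count_singleton, one_div]

theorem IsUniform.measure_preimage {A : Ω → α} (h : IsUniform A P) (a : α) :
    P (A ⁻¹' {a}) = (Fintype.card α : ENNReal)⁻¹ := by
  rw [← Measure.map_apply h.1 (measurableSet_singleton _), h.2, uniformOn_univ_singleton]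

theorem isUniform_of_measure_preimage {A : Ω → α} (hA : Measurable A)
    (h : ∀ a, P (A ⁻¹' {a}) = (Fintype.card α : ENNReal)⁻¹) : IsUniform A P := by
  refine ⟨hA, Measure.ext_of_singleton fun a => ?_⟩
  rw [Measure.map_apply hA (measurableSet_singleton _), h, uniformOn_univ_singleton]

/-- One-time pad: adding to a uniform `U` a function of an independent `V` keeps it uniform and
independent of `V`. -/
theorem IsUniform.shift [IsProbabilityMeasure P] [AddCommGroup α] [MeasurableSpace β]
    [MeasurableSingletonClass β] [Countable β] {U U' : Ω → α} {V : Ω → β} (hU : IsUniform U P)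
    (hV : Measurable V) (hUV : IndepFun U V P)
    (h : ∀ ω ω', V ω = V ω' → U' ω - U ω = U' ω' - U ω') :
    IsUniform U' P ∧ IndepFun U' V P := by
  have hm : Measurable U' := by
    refine measurable_of_factor (hU.1.prodMk hV) fun ω ω' hω => ?_
    have h1 := h ω ω' (Prod.ext_iff.1 hω).2
    have h2 : U ω = U ω' := (Prod.ext_iff.1 hω).1
    rw [h2] at h1
    exact sub_left_injective h1
  have : Nonempty Ω := nonempty_of_isProbabilityMeasure P
  have : Nonempty α := ⟨0⟩
  have : IsProbabilityMeasure (uniformOn (Set.univ : Set α)) :=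
    isProbabilityMeasure_uniformOn Set.finite_univ Set.univ_nonempty
  refine (map_eq_and_indepFun_of_singleton hm hV (uniformOn Set.univ) fun a b => ?_).imp_left
    fun h => ⟨hm, h⟩
  rw [uniformOn_univ_singleton]
  by_cases hb : ∃ ω₀, V ω₀ = b
  · obtain ⟨ω₀, rfl⟩ := hb
    -- On the event `V = V ω₀` the shift is constant, so prescribing `U'` there prescribes `U`.
    rw [← hU.measure_preimage (a - (U' ω₀ - U ω₀)), ← hUV.measure_inter_preimage_eq_mul _ _
      (measurableSet_singleton _) (measurableSet_singleton _)]
    congr 1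
    ext ω
    simp only [Set.mem_inter_iff, Set.mem_preimage, Set.mem_singleton_iff]
    refine and_congr_left fun hω => ?_
    rw [← h ω ω₀ hω, sub_sub_eq_add_sub, eq_sub_iff_add_eq, add_comm (U ω), add_left_inj]
  · have : V ⁻¹' {b} = ∅ := by
      ext ω
      simpa using fun h' => hb ⟨ω, h'⟩
    simp [this]

theorem IsUniform.pi [IsProbabilityMeasure P] {ι : Type*} [Fintype ι] [DecidableEq ι]
    {α : ι → Type*} [∀ i, MeasurableSpace (α i)] [∀ i, MeasurableSingletonClass (α i)]
    [∀ i, Fintype (α i)] {A : ∀ i, Ω → α i} (h : ∀ i, IsUniform (A i) P) (hi : iIndepFun A P) :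
    IsUniform (fun ω i => A i ω) P := by
  refine isUniform_of_measure_preimage (measurable_pi_lambda _ fun i => (h i).1) fun a => ?_
  have := hi.measure_inter_preimage_eq_mul Finset.univ (sets := fun i => {a i})
    fun i _ => measurableSet_singleton _
  simp only [(h _).measure_preimage] at this
  rw [Fintype.card_pi, Nat.cast_prod, ENNReal.prod_inv_distrib (by simp [Set.Pairwise]), ← this]
  congr 1
  ext ω
  simp [funext_iff]

/-- The image of a uniform element under a surjective homomorphism is uniform. -/
theorem IsUniform.map_addHom [IsProbabilityMeasure P] [AddCommGroup α] [AddCommGroup β]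
    [Fintype β] [MeasurableSpace β] [MeasurableSingletonClass β] {U : Ω → α} (hU : IsUniform U P)
    (φ : α →+ β) (hφ : Function.Surjective φ) : IsUniform (fun ω => φ (U ω)) P := by
  have hm : Measurable fun ω => φ (U ω) := (Measurable.of_discrete (f := φ)).comp hU.1
  -- All fibres are equally likely: translation by a preimage of `b' - b` preserves the law of `U`
  -- and carries one fibre to the other.
  have hc : ∀ b b', P ((fun ω => φ (U ω)) ⁻¹' {b}) = P ((fun ω => φ (U ω)) ⁻¹' {b'}) := by
    intro b b'
    obtain ⟨s, hs⟩ := hφ (b' - b)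
    have hshift := (hU.shift (U' := fun ω => U ω + s) (V := fun _ => ()) measurable_const
      (indepFun_const_right _ _) fun _ _ _ => by simp).1
    have e : (fun ω => φ (U ω)) ⁻¹' {b} = (fun ω => U ω + s) ⁻¹' (φ ⁻¹' {b'}) := by
      ext ω
      simp only [Set.mem_preimage, Set.mem_singleton_iff, map_add, hs]
      rw [← eq_sub_iff_add_eq, sub_sub_cancel]
    rw [e, ← Measure.map_apply hshift.1 (MeasurableSet.of_discrete), hshift.2, ← hU.2,
      Measure.map_apply hU.1 (MeasurableSet.of_discrete)]
    rfl
  refine isUniform_of_measure_preimage hm fun b => ?_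
  have hsum : ∑ b', P ((fun ω => φ (U ω)) ⁻¹' {b'}) = 1 := by
    have := Measure.isProbabilityMeasure_map (μ := P) hm.aemeasurable
    rw [← measure_univ (μ := P.map fun ω => φ (U ω)), ← Finset.coe_univ, ← sum_measure_singleton]
    exact Finset.sum_congr rfl fun b' _ => (Measure.map_apply hm (measurableSet_singleton _)).symm
  rw [Finset.sum_congr rfl fun b' _ => hc b' b, Finset.sum_const, nsmul_eq_mul,
    Finset.card_univ] at hsum
  exact ENNReal.eq_inv_of_mul_eq_one_left ((mul_comm _ _).trans hsum)

end Uniform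

/-! ### Criteria for vanishing information. -/

section Entropy

variable {Ω : Type*} [MeasurableSpace Ω] {P : Measure Ω} (q : ℕ)
  {α β γ δ : Type*} [Fintype α] [Fintype β] [Fintype γ]

theorem sum_real_preimage_singleton [IsProbabilityMeasure P] [MeasurableSpace α]
    [MeasurableSingletonClass α] {A : Ω → α} (hA : Measurable A) :
    ∑ a, P.real (A ⁻¹' {a}) = 1 := by
  have := Measure.isProbabilityMeasure_map (μ := P) hA.aemeasurable
  have h := sum_measureReal_singleton (μ := P.map A) Finset.univ
  rw [Finset.coe_univ, probReal_univ] at h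
  rw [← h]
  exact Finset.sum_congr rfl fun a _ => (map_measureReal_apply hA (measurableSet_singleton _)).symm

theorem entropy_prodMk_of_indepFun [IsProbabilityMeasure P] [MeasurableSpace α]
    [MeasurableSingletonClass α] [MeasurableSpace β] [MeasurableSingletonClass β]
    {A : Ω → α} {B : Ω → β} (hA : Measurable A) (hB : Measurable B) (h : IndepFun A B P) :
    entropy q P (fun ω => (A ω, B ω)) = entropy q P A + entropy q P B := by
  unfold entropy
  rw [← add_div, Fintype.sum_prod_type]
  congr 1
  have e : ∀ a b, P.real ((fun ω => (A ω, B ω)) ⁻¹' {(a, b)})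
      = P.real (A ⁻¹' {a}) * P.real (B ⁻¹' {b}) := by
    intro a b
    rw [← Set.singleton_prod_singleton, Set.mk_preimage_prod, measureReal_def,
      h.measure_inter_preimage_eq_mul _ _ (measurableSet_singleton _) (measurableSet_singleton _),
      ENNReal.toReal_mul]
    rfl
  simp only [e, Real.negMulLog_mul, Finset.sum_add_distrib, ← Finset.mul_sum, ← Finset.sum_mul,
    sum_real_preimage_singleton hA, sum_real_preimage_singleton hB, one_mul]

theorem mutualInfo_eq_zero [IsProbabilityMeasure P] [MeasurableSpace α]
    [MeasurableSingletonClass α] [MeasurableSpace δ] [DiscreteMeasurableSpace δ]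
    {A : Ω → α} {B : Ω → β} {V : Ω → δ} (hA : Measurable A) (hV : Measurable V)
    (h : IndepFun A V P) (hB : ∀ ω ω', V ω = V ω' → B ω = B ω') : mutualInfo q P A B = 0 := by
  have : Nonempty Ω := nonempty_of_isProbabilityMeasure P
  have : Nonempty β := ⟨B (Classical.arbitrary Ω)⟩
  -- Entropy sees only point preimages, so any σ-algebra on `β` will do; the factor map is
  -- measurable because `δ` is discrete.
  let _ : MeasurableSpace β := ⊤
  obtain ⟨g, rfl⟩ := (Function.factorsThrough_iff B (f := V)).1 fun ω ω' => hB ω ω'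
  have hg : Measurable g := Measurable.of_discrete
  rw [mutualInfo, entropy_prodMk_of_indepFun q hA (hg.comp hV) (h.comp measurable_id hg), sub_self]

/-- Chain rule: `I(A ; B | C) = I(A ; (B, C)) - I(A ; C)`, and both terms vanish. -/
theorem condMutualInfo_eq_zero [IsProbabilityMeasure P] [MeasurableSpace α]
    [MeasurableSingletonClass α] [MeasurableSpace δ] [DiscreteMeasurableSpace δ]
    {A : Ω → α} {B : Ω → β} {C : Ω → γ} {V : Ω → δ} (hA : Measurable A) (hV : Measurable V)
    (h : IndepFun A V P) (hB : ∀ ω ω', V ω = V ω' → B ω = B ω')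
    (hC : ∀ ω ω', V ω = V ω' → C ω = C ω') : condMutualInfo q P A B C = 0 := by
  have h1 := mutualInfo_eq_zero q hA hV h hC
  have h2 := mutualInfo_eq_zero q (B := fun ω => (B ω, C ω)) hA hV h fun ω ω' e => by
    rw [hB ω ω' e, hC ω ω' e]
  unfold mutualInfo at h1 h2
  unfold condMutualInfo
  linarith

/-- Above each attained value of `B` sits a single value of `A` carrying all the mass, so the joint
entropy sum collapses to that of `B`. -/
theorem condEntropy_eq_zero {A : Ω → α} {B : Ω → β} (h : ∀ ω ω', B ω = B ω' → A ω = A ω') :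
    condEntropy q P A B = 0 := by
  classical
  unfold condEntropy entropy
  rw [sub_eq_zero, Fintype.sum_prod_type_right]
  congr 1
  refine Finset.sum_congr rfl fun b _ => ?_
  by_cases hb : ∃ ω₀, B ω₀ = b
  · obtain ⟨ω₀, rfl⟩ := hb
    rw [Finset.sum_eq_single (A ω₀)]
    · congr 2
      ext ω
      simpa using fun e => h _ _ e
    · intro a _ ha
      have : (fun ω => (A ω, B ω)) ⁻¹' {(a, B ω₀)} = ∅ := by
        ext ω
        simp only [Set.mem_preimage, Set.mem_singleton_iff, Prod.mk.injEq, Set.mem_empty_iff_false,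
          iff_false, not_and]
        exact fun e e' => ha (e ▸ h _ _ e')
      simp [this]
    · simp
  · have hB : B ⁻¹' {b} = ∅ := by
      ext ω
      simpa using fun h' => hb ⟨ω, h'⟩
    have hAB : ∀ a, (fun ω => (A ω, B ω)) ⁻¹' {(a, b)} = ∅ := by
      intro a
      ext ω
      simpa using fun _ h' => hb ⟨ω, h'⟩
    simp [hB, hAB]

theorem IsUniform.entropy_eq [MeasurableSpace α] [MeasurableSingletonClass α] [Nonempty α]
    {A : Ω → α} (h : IsUniform A P) : entropy q P A = Real.log (Fintype.card α) / Real.log q := by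
  unfold entropy
  have hc : (Fintype.card α : ℝ) ≠ 0 := by simp
  simp only [measureReal_def, h.measure_preimage, ENNReal.toReal_inv, ENNReal.toReal_natCast,
    Real.negMulLog, Real.log_inv, Finset.sum_const, Finset.card_univ, nsmul_eq_mul]
  field_simp

end Entropy

end ACSA

namespace ACSA

open Polynomial

/-! ### Rational functions with simple poles -/

section RationalFunctions

variable {F : Type*} [Field F]

/-- The polynomial with coefficients `z 0, …, z (m - 1)`. -/
noncomputable def coeffPoly {m : ℕ} (z : Fin m → F) : F[X] := ∑ s : Fin m, C (z s) * X ^ (s : ℕ)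

theorem eval_coeffPoly {m : ℕ} (z : Fin m → F) (a : F) :
    (coeffPoly z).eval a = ∑ s : Fin m, a ^ (s : ℕ) * z s := by
  rw [coeffPoly, eval_finsetSum]
  refine Finset.sum_congr rfl fun i _ => ?_
  rw [eval_mul, eval_C, eval_pow, eval_X, mul_comm]

theorem degree_coeffPoly_lt {m : ℕ} (z : Fin m → F) : (coeffPoly z).degree < m :=
  degree_sum_fin_lt z

theorem exists_coeff_of_degree_lt {m : ℕ} {p : F[X]} (hp : p.degree < m) :
    ∃ z : Fin m → F, ∀ a, p.eval a = ∑ s : Fin m, a ^ (s : ℕ) * z s := by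
  refine ⟨degreeLTEquiv F m ⟨p, mem_degreeLT.2 hp⟩, fun a => ?_⟩
  rw [eval_eq_sum_degreeLTEquiv (mem_degreeLT.2 hp)]
  exact Finset.sum_congr rfl fun i _ => mul_comm _ _

/-- Source of all masking: noise with `m` coefficients can imitate any secret-dependent offset seen
at no more than `m` servers. -/
theorem exists_coeff_interpolate {κ : Type*} {a : κ → F} (ha : Function.Injective a)
    {m : ℕ} (s : Finset κ) (hs : s.card ≤ m) (v : κ → F) :
    ∃ z : Fin m → F, ∀ n ∈ s, ∑ x : Fin m, a n ^ (x : ℕ) * z x = v n := by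
  classical
  have hd : (Lagrange.interpolate s a v).degree < m :=
    (Lagrange.degree_interpolate_lt v ha.injOn).trans_le (by exact_mod_cast hs)
  obtain ⟨z, hz⟩ := exists_coeff_of_degree_lt hd
  exact ⟨z, fun n hn => by rw [← hz, Lagrange.eval_interpolate_at_node v ha.injOn hn]⟩

theorem degree_sum_lt' {ι : Type*} {s : Finset ι} {p : ι → F[X]} {m : ℕ}
    (h : ∀ i ∈ s, (p i).degree < m) : (∑ i ∈ s, p i).degree < m :=
  mem_degreeLT.1 (Submodule.sum_mem _ fun i hi => mem_degreeLT.2 (h i hi))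

theorem degree_divByMonic_X_sub_C_lt {p : F[X]} {D : ℕ} (hp : p.natDegree ≤ D) (f : F) :
    (p /ₘ (X - C f)).degree < D := by
  by_cases h0 : p = 0
  · simp only [h0, zero_divByMonic, degree_zero]
    exact WithBot.bot_lt_coe D
  · exact (degree_divByMonic_lt p _ h0 (by simp)).trans_le
      (degree_le_of_natDegree_le hp)

/-- Multiplying a sum of simple fractions and a polynomial by a polynomial `p` scales the residue at
each pole by the value of `p` there, up to a polynomial. -/
theorem exists_mul_simple_fractions {ι : Type*} {p w : F[X]} {D E : ℕ} (hp : p.natDegree ≤ D)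
    (hw : w.degree < E) (s : Finset ι) (f u : ι → F) :
    ∃ r : F[X], r.degree < (D + E : ℕ) ∧ ∀ a, (∀ i ∈ s, a ≠ f i) →
      p.eval a * (∑ i ∈ s, u i / (a - f i) + w.eval a)
        = ∑ i ∈ s, u i * p.eval (f i) / (a - f i) + r.eval a := by
  -- Dividing `p` by `X - f i` leaves the remainder `p (f i)`, the new residue factor; the quotients
  -- and `p * w` form the polynomial part.
  refine ⟨∑ i ∈ s, C (u i) * (p /ₘ (X - C (f i))) + p * w, ?_, fun a ha => ?_⟩
  · refine (degree_add_le _ _).trans_lt (max_lt (degree_sum_lt' fun i _ => ?_) ?_)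
    · have h1 := degree_divByMonic_X_sub_C_lt hp (f i)
      have h2 : ((D : ℕ) : WithBot ℕ) ≤ ((D + E : ℕ) : WithBot ℕ) := by
        exact_mod_cast Nat.le_add_right D E
      refine lt_of_le_of_lt ?_ (h1.trans_le h2)
      by_cases hu : u i = 0
      · simp [hu]
      · rw [degree_C_mul hu]
    · by_cases hp0 : p = 0
      · simp only [hp0, zero_mul, degree_zero]
        exact WithBot.bot_lt_coe _
      · rw [degree_mul, degree_eq_natDegree hp0, Nat.cast_add]
        refine lt_of_lt_of_le (WithBot.add_lt_add_left (by simp) hw) ?_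
        gcongr
  · rw [mul_add, Finset.mul_sum, eval_add, eval_mul, eval_finsetSum, ← add_assoc,
      ← Finset.sum_add_distrib]
    congr 1
    refine Finset.sum_congr rfl fun i hi => ?_
    have h := congrArg (eval a) (modByMonic_add_div p (X - C (f i)))
    rw [modByMonic_X_sub_C_eq_C_eval] at h
    simp only [eval_add, eval_C, eval_mul, eval_sub, eval_X] at h
    have hne : a - f i ≠ 0 := sub_ne_zero.2 (ha i hi)
    rw [eval_mul, eval_C, ← h]
    field_simp

/-- The columns of a Cauchy–Vandermonde matrix are independent, here for the Cauchy part. -/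
theorem eq_zero_of_simple_fractions_eq_zero {ι κ : Type*} [DecidableEq ι] {s : Finset ι}
    {f u : ι → F} (hf : Set.InjOn f s) {r : F[X]} {d : ℕ} (hr : r.degree < d) {M : Finset κ}
    {a : κ → F} (ha : Set.InjOn a M) (haf : ∀ n ∈ M, ∀ i ∈ s, a n ≠ f i)
    (hM : s.card + d ≤ M.card)
    (h : ∀ n ∈ M, ∑ i ∈ s, u i / (a n - f i) + r.eval (a n) = 0) : ∀ i ∈ s, u i = 0 := by
  have hprod : ∀ s' : Finset ι, (∏ i ∈ s', (X - C (f i))).degree = ((s'.card : ℕ) : WithBot ℕ) := by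
    intro s'
    simp [degree_prod]
  -- Clearing denominators gives a polynomial of degree below `s.card + d` with a root at each point
  -- of `M`.
  have hp : ∑ i ∈ s, C (u i) * ∏ j ∈ s.erase i, (X - C (f j)) + r * ∏ j ∈ s, (X - C (f j)) = 0 := by
    refine eq_zero_of_degree_lt_of_eval_index_eq_zero M ha ?_ fun n hn => ?_
    · refine lt_of_lt_of_le ?_ (show ((s.card + d : ℕ) : WithBot ℕ) ≤ _ by exact_mod_cast hM)
      refine (degree_add_le _ _).trans_lt (max_lt (degree_sum_lt' fun i hi => ?_) ?_)
      · refine lt_of_le_of_lt (degree_mul_le _ _) ?_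
        rw [hprod, Finset.card_erase_of_mem hi]
        have hs : 0 < s.card := Finset.card_pos.2 ⟨i, hi⟩
        refine lt_of_le_of_lt (add_le_add_left degree_C_le _) ?_
        rw [zero_add]
        exact_mod_cast (by omega : s.card - 1 < s.card + d)
      · rw [degree_mul, hprod, Nat.cast_add, add_comm]
        exact WithBot.add_lt_add_left (by simp) hr
    · have hne : ∀ i ∈ s, a n - f i ≠ 0 := fun i hi => sub_ne_zero.2 (haf n hn i hi)
      have h1 := congrArg (· * ∏ j ∈ s, (a n - f j)) (h n hn)
      simp only [zero_mul, add_mul, Finset.sum_mul] at h1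
      rw [eval_add, eval_finsetSum, eval_mul, eval_prod]
      rw [← h1]
      simp only [eval_sub, eval_X, eval_C, eval_mul, eval_prod]
      congr 1
      refine Finset.sum_congr rfl fun i hi => ?_
      rw [← Finset.mul_prod_erase s _ hi]
      field_simp [hne i hi]
  intro i hi
  -- At `f i` every term except the one of `u i` contains a vanishing factor.
  have h1 := congrArg (eval (f i)) hp
  rw [eval_add, eval_finsetSum, eval_mul, eval_prod,
    Finset.sum_eq_single i, Finset.prod_eq_zero hi (by simp)] at h1
  · simp only [eval_mul, eval_C, mul_zero, add_zero, eval_zero, eval_prod, eval_sub, eval_X] at h1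
    refine (mul_eq_zero.1 h1).resolve_right (Finset.prod_ne_zero_iff.2 fun j hj => ?_)
    rw [Finset.mem_erase] at hj
    exact sub_ne_zero.2 fun e => hj.1 (hf hj.2 hi e.symm)
  · intro j hj hji
    rw [eval_mul, eval_prod, Finset.prod_eq_zero (Finset.mem_erase.2 ⟨hji.symm, hi⟩) (by simp),
      mul_zero]
  · exact fun h => absurd hi h

end RationalFunctions

/-! ### Poles and blocks -/

section Poles

theorem mod_eq_ite_of_lt_two_mul {x m : ℕ} (h : x < 2 * m) :
    x % m = if x < m then x else x - m := by
  split_ifs with h'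
  · exact Nat.mod_eq_of_lt h'
  · rw [Nat.mod_eq_sub_mod (by omega), Nat.mod_eq_of_lt (by omega)]

/-- In a fixed column the index is `r` or `-r` plus a constant, modulo a number no smaller than the
number of rows. -/
theorem poleIdx_left_injective (p : Params) (i : Fin p.Kc) :
    Function.Injective fun r => p.poleIdx r i := by
  intro r r' h
  have hr := r.2
  have hr' := r'.2
  have hi := i.2
  have h := congrArg Fin.val h
  ext
  simp only [Params.poleIdx] at h
  split_ifs at h <;>
  · rw [mod_eq_ite_of_lt_two_mul (by omega), mod_eq_ite_of_lt_two_mul (by omega)] at h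
    split_ifs at h <;> omega

theorem poleIdx_right_injective (p : Params) (r : Fin p.mu) :
    Function.Injective (p.poleIdx r) := by
  intro i i' h
  have hr := r.2
  have hi' := i'.2
  have hi := i.2
  have h := congrArg Fin.val h
  ext
  simp only [Params.poleIdx] at h
  split_ifs at h <;>
  · rw [mod_eq_ite_of_lt_two_mul (by omega), mod_eq_ite_of_lt_two_mul (by omega)] at h
    split_ifs at h <;> omega

/-- Equal quotients put the two numbers less than `R ≤ m` apart, while `m` divides their difference.
-/
theorem eq_of_div_eq_of_mod_eq {R m a b : ℕ} (hR : 0 < R) (hRm : R ≤ m) (hd : a / R = b / R)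
    (hm : a % m = b % m) : a = b := by
  have key : ∀ a b : ℕ, a ≤ b → a / R = b / R → a % m = b % m → a = b := by
    intro a b hab hd hm
    have h1 : m ∣ b - a := (Nat.modEq_iff_dvd' hab).1 hm
    have h2 := Nat.div_add_mod a R
    have h3 := Nat.div_add_mod b R
    have h4 := Nat.mod_lt b hR
    rw [hd] at h2
    have := Nat.eq_zero_of_dvd_of_lt h1 (by omega)
    omega
  rcases le_total a b with h | h
  · exact key a b h hd hm
  · exact (key b a h hd.symm hm.symm).symm

theorem card_filter_div_eq_le {J R : ℕ} (hR : 0 < R) (s : Finset (Fin J)) (l : ℕ)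
    (hs : ∀ j ∈ s, (j : ℕ) / R = l) : s.card ≤ R := by
  rw [← Finset.card_range R]
  refine Finset.card_le_card_of_injOn (fun j => (j : ℕ) % R)
    (fun j _ => Finset.mem_coe.2 (Finset.mem_range.2 (Nat.mod_lt _ hR))) fun j hj j' hj' h => ?_
  exact Fin.ext (eq_of_div_eq_of_mod_eq hR le_rfl ((hs j hj).trans (hs j' hj').symm) h)

variable {p : Params} {F : Type*} {ξ : ℕ} (c : Constants p F)

theorem Constants.α_injective : Function.Injective c.α := fun a b h => by
  simpa using @c.distinct (Sum.inl a) (Sum.inl b) h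

theorem Constants.ft_injective : Function.Injective c.ft := fun a b h => by
  simpa using @c.distinct (Sum.inr a) (Sum.inr b) h

theorem Constants.α_ne_ft (n : Fin p.N) (m : Fin (max p.mu p.Kc)) : c.α n ≠ c.ft m := fun h => by
  simpa using @c.distinct (Sum.inl n) (Sum.inr m) h

theorem α_ne_pole (n : Fin p.N) (j : Fin (p.J ξ)) (i : Fin p.Kc) : c.α n ≠ pole c j i :=
  c.α_ne_ft _ _

theorem pole_injective (j : Fin (p.J ξ)) : Function.Injective (pole c j) := fun _ _ h =>
  poleIdx_right_injective p _ (c.ft_injective h)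

/-- This is why `mu` bounds both thresholds: a block no longer than the period meets each pole of a
column at most once. -/
theorem eq_of_pole_eq {j j' : Fin (p.J ξ)} {i : Fin p.Kc} {R : ℕ} (hR : 0 < R) (hRm : R ≤ p.mu)
    (hd : (j : ℕ) / R = j' / R) (h : pole c j i = pole c j' i) : j = j' := by
  have h1 := poleIdx_left_injective p i (c.ft_injective h)
  exact Fin.ext (eq_of_div_eq_of_mod_eq hR hRm hd (congrArg Fin.val h1))

theorem Params.Rr_le_mu (t : ℕ) : p.Rr t ≤ p.mu := (Nat.sub_le _ _).trans (le_max_left _ _)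

theorem Params.Rw_le_mu (t : ℕ) : p.Rw t ≤ p.mu := (Nat.sub_le _ _).trans (le_max_right _ _)

theorem eq_of_pole_eq_of_blockR_eq {t : ℕ} {j j' : Fin (p.J ξ)} {i : Fin p.Kc}
    (hb : p.blockR t j = p.blockR t j') (h : pole c j i = pole c j' i) : j = j' :=
  eq_of_pole_eq c (p.Rr_pos t) (p.Rr_le_mu t) (congrArg Fin.val hb) h

theorem eq_of_pole_eq_of_blockW_eq {t : ℕ} {j j' : Fin (p.J ξ)} {i : Fin p.Kc}
    (hb : p.blockW t j = p.blockW t j') (h : pole c j i = pole c j' i) : j = j' :=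
  eq_of_pole_eq c (p.Rw_pos t) (p.Rw_le_mu t) (congrArg Fin.val hb) h

theorem card_blockR_le (t : ℕ) (l : Fin (p.numR ξ t)) :
    (Finset.univ.filter fun j : Fin (p.J ξ) => p.blockR t j = l).card ≤ p.Rr t :=
  card_filter_div_eq_le (p.Rr_pos t) _ l fun _ hj =>
    congrArg Fin.val (Finset.mem_filter.1 hj).2

theorem card_blockW_le (t : ℕ) (l : Fin (p.numW ξ t)) :
    (Finset.univ.filter fun j : Fin (p.J ξ) => p.blockW t j = l).card ≤ p.Rw t :=
  card_filter_div_eq_le (p.Rw_pos t) _ l fun _ hj =>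
    congrArg Fin.val (Finset.mem_filter.1 hj).2

theorem card_blockW_erase_le (t : ℕ) (j : Fin (p.J ξ)) :
    (Finset.univ.filter fun j' : Fin (p.J ξ) => p.blockW t j' = p.blockW t j ∧ j' ≠ j).card
      ≤ p.Rw t - 1 := by
  have h : (Finset.univ.filter fun j' : Fin (p.J ξ) => p.blockW t j' = p.blockW t j ∧ j' ≠ j)
      = (Finset.univ.filter fun j' : Fin (p.J ξ) => p.blockW t j' = p.blockW t j).erase j := by
    ext j'
    simp [and_comm]
  rw [h, Finset.card_erase_of_mem (by simp)]
  exact Nat.sub_le_sub_right (card_blockW_le t _) 1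

end Poles

end ACSA

namespace ACSA

open Polynomial

/-! ### Algebraic structure of the storage, the answers and the update -/

section SchemeAlgebra

variable {p : Params} {F : Type*} [Field F] {K ξ : ℕ} (c : Constants p F)

theorem entry_add (w w' : Fin (p.L ξ) → F) (j : Fin (p.J ξ)) (i : Fin p.Kc) :
    entry (w + w') j i = entry w j i + entry w' j i := rfl

theorem entry_zero (j : Fin (p.J ξ)) (i : Fin p.Kc) :
    entry (0 : Fin (p.L ξ) → F) j i = 0 := rfl

theorem acsaStorage_add (n : Fin p.N) (W W' : Submodels p F K ξ) (Z Z' : StorageNoise p F K ξ) :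
    acsaStorage c n (W + W') (Z + Z') = acsaStorage c n W Z + acsaStorage c n W' Z' := by
  funext j k
  simp only [acsaStorage, Pi.add_apply, entry_add, mul_add, Finset.sum_add_distrib]
  ring

/-- The read query for submodel `θ` as a polynomial in the evaluation point. -/
noncomputable def queryPoly (θ : Fin K) (z : ReadNoise p F K) (j : Fin (p.J ξ)) (i : Fin p.Kc)
    (k : Fin K) : F[X] :=
  C (if k = θ then 1 else 0) + (X - C (pole c j i)) * coeffPoly fun s => z (p.row j) i s k

theorem eval_queryPoly (θ : Fin K) (z : ReadNoise p F K) (j : Fin (p.J ξ)) (i : Fin p.Kc)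
    (k : Fin K) (n : Fin p.N) :
    (queryPoly c θ z j i k).eval (c.α n) = readQuery c n θ z j i k := by
  simp only [queryPoly, eval_add, eval_C, eval_mul, eval_sub, eval_X, eval_coeffPoly, readQuery]

theorem eval_pole_queryPoly (θ : Fin K) (z : ReadNoise p F K) (j : Fin (p.J ξ)) (i : Fin p.Kc)
    (k : Fin K) : (queryPoly c θ z j i k).eval (pole c j i) = if k = θ then 1 else 0 := by
  simp only [queryPoly, eval_add, eval_C, eval_mul, eval_sub, eval_X, sub_self, zero_mul, add_zero]

theorem natDegree_queryPoly_le (θ : Fin K) (z : ReadNoise p F K) (j : Fin (p.J ξ)) (i : Fin p.Kc)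
    (k : Fin K) : (queryPoly c θ z j i k).natDegree ≤ p.T := by
  have h := degree_coeffPoly_lt fun s => z (p.row j) i s k
  refine natDegree_add_le_of_degree_le ((natDegree_C _).le.trans (Nat.zero_le _)) ?_
  by_cases h0 : (coeffPoly fun s => z (p.row j) i s k) = 0
  · simp [h0]
  · have h1 := (natDegree_lt_iff_degree_lt h0).2 h
    refine natDegree_mul_le.trans ?_
    rw [natDegree_X_sub_C]
    omega

theorem natDegree_prod_X_sub_C_le {ι : Type*} (s : Finset ι) (f : ι → F) :
    (∏ i ∈ s, (X - C (f i))).natDegree ≤ s.card := by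
  refine (natDegree_prod_le _ _).trans ?_
  simp

/-- The noise in the answers: the answer is a sum of simple fractions that carry the desired
symbols, and a polynomial with `Kc + X + T - 1` coefficients. -/
theorem exists_answer_eq (t : ℕ) (W : Submodels p F K ξ) (Z : StorageNoise p F K ξ) (θ : Fin K)
    (z : ReadNoise p F K) (l : Fin (p.numR ξ t)) (i : Fin p.Kc) :
    ∃ r : F[X], r.degree < (p.Kc - 1 + p.T + p.X : ℕ) ∧ ∀ n,
      answer c t n (acsaStorage c n W Z) (readQuery c n θ z) l i
        = ∑ j with p.blockR t j = l, entry (W θ) j i / (c.α n - pole c j i) + r.eval (c.α n) := by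
  -- Packer times query as a polynomial in the evaluation point, with degree at most `Kc - 1 + T`.
  let N : Fin (p.J ξ) → Fin K → F[X] := fun j k =>
    C (∏ i' ∈ Finset.univ.erase i, (pole c j i - pole c j i'))⁻¹ *
      (∏ i' ∈ Finset.univ.erase i, (X - C (pole c j i'))) * queryPoly c θ z j i k
  have hN : ∀ j k n, (N j k).eval (c.α n) = packer c n i j * readQuery c n θ z j i k := by
    intro j k n
    simp only [N, eval_mul, eval_prod, eval_sub, eval_X, eval_C, eval_queryPoly, packer]
    ring
  have hself : ∀ j k, (N j k).eval (pole c j i) = if k = θ then 1 else 0 := by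
    intro j k
    simp only [N, eval_mul, eval_prod, eval_sub, eval_X, eval_C, eval_pole_queryPoly]
    rw [inv_mul_cancel₀, one_mul]
    refine Finset.prod_ne_zero_iff.2 fun i' hi' => sub_ne_zero.2 fun e => ?_
    exact (Finset.mem_erase.1 hi').1 (pole_injective c j e.symm)
  have hother : ∀ j k i', i' ≠ i → (N j k).eval (pole c j i') = 0 := by
    intro j k i' hi'
    simp only [N, eval_mul, eval_prod, eval_sub, eval_X, eval_C]
    rw [Finset.prod_eq_zero (f := fun x => pole c j i' - pole c j x)
      (Finset.mem_erase.2 ⟨hi', Finset.mem_univ _⟩) (sub_self _)]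
    ring
  have hdeg : ∀ j k, (N j k).natDegree ≤ p.Kc - 1 + p.T := by
    intro j k
    refine natDegree_mul_le_of_le ?_ (natDegree_queryPoly_le c θ z j i k)
    refine (natDegree_C_mul_le _ _).trans ((natDegree_prod_X_sub_C_le _ _).trans ?_)
    rw [Finset.card_erase_of_mem (Finset.mem_univ _), Finset.card_univ, Fintype.card_fin]
  choose r hr hr' using fun j k => exists_mul_simple_fractions (hdeg j k)
    (degree_coeffPoly_lt fun x => Z j x k) Finset.univ (pole c j) (entry (W k) j)
  refine ⟨∑ j with p.blockR t j = l, ∑ k, r j k,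
    degree_sum_lt' fun j _ => degree_sum_lt' fun k _ => hr j k, fun n => ?_⟩
  rw [answer, eval_finsetSum, ← Finset.sum_add_distrib]
  refine Finset.sum_congr rfl fun j _ => ?_
  have key : ∀ k, acsaStorage c n W Z j k * (packer c n i j * readQuery c n θ z j i k)
      = (if k = θ then entry (W k) j i / (c.α n - pole c j i) else 0) + (r j k).eval (c.α n) := by
    intro k
    have h := hr' j k (c.α n) fun i' _ => α_ne_pole c n j i'
    rw [hN, eval_coeffPoly, Finset.sum_eq_single (s := Finset.univ)
      (f := fun i' => entry (W k) j i' * eval (pole c j i') (N j k) / (c.α n - pole c j i')) i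
      (fun i' _ hi' => by rw [hother j k i' hi']; simp) (by simp), hself] at h
    have hS : acsaStorage c n W Z j k = ∑ i', entry (W k) j i' / (c.α n - pole c j i')
        + ∑ x : Fin p.X, c.α n ^ (x : ℕ) * Z j x k := by
      simp only [acsaStorage, div_eq_inv_mul, mul_one]
    rw [hS, mul_comm, h]
    split_ifs <;> simp
  simp only [key, Finset.sum_add_distrib, Finset.sum_ite_eq', Finset.mem_univ, if_true,
    eval_finsetSum]

/-- The answers of the servers that are available determine the desired submodel. -/
theorem eq_of_answer_eq (t : ℕ) {W W' : Submodels p F K ξ} {Z Z' : StorageNoise p F K ξ}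
    {θ : Fin K} {z z' : ReadNoise p F K}
    (h : ∀ n, n ∉ p.Sr t → answer c t n (acsaStorage c n W Z) (readQuery c n θ z)
      = answer c t n (acsaStorage c n W' Z') (readQuery c n θ z')) : W θ = W' θ := by
  funext m
  obtain ⟨⟨j, i⟩, rfl⟩ := finProdFinEquiv.surjective m
  obtain ⟨r, hr, hr'⟩ := exists_answer_eq c t W Z θ z (p.blockR t j) i
  obtain ⟨s, hs, hs'⟩ := exists_answer_eq c t W' Z' θ z' (p.blockR t j) i
  -- At most `Rr t` residues plus the polynomial coefficients: `Rr t` is chosen so that the total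
  -- does not exceed the number of answers.
  have hcard : (Finset.univ.filter fun j' : Fin (p.J ξ) => p.blockR t j' = p.blockR t j).card
      + (p.Kc - 1 + p.T + p.X) ≤ ((p.Sr t)ᶜ).card := by
    have h1 := card_blockR_le (ξ := ξ) t (p.blockR t j)
    have h2 := p.card_Sr_lt t
    have h3 := p.Kc_pos
    have h4 := Finset.card_compl (p.Sr t)
    rw [Fintype.card_fin] at h4
    unfold Params.Rr Params.SrThresh at h1
    unfold readThresh at h1 h2
    omega
  -- Applied to the difference of the two answers, whose residues are differences of desired
  -- symbols.
  have := eq_zero_of_simple_fractions_eq_zero (f := fun j' => pole c j' i)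
    (u := fun j' => entry (W θ) j' i - entry (W' θ) j' i) (r := r - s) (a := c.α)
    (M := (p.Sr t)ᶜ) ?_ (lt_of_le_of_lt (degree_sub_le r s) (max_lt hr hs))
    c.α_injective.injOn (fun n _ j' _ => α_ne_pole c n j' i) hcard ?_ j (by simp)
  · exact sub_eq_zero.1 this
  · intro j₁ h₁ j₂ h₂ e
    simp only [Finset.coe_filter, Finset.mem_univ, true_and, Set.mem_ofPred_eq] at h₁ h₂
    exact eq_of_pole_eq_of_blockR_eq c (h₁.trans h₂.symm) e
  · intro n hn
    have e := congrFun (congrFun (h n (Finset.mem_compl.1 hn)) (p.blockR t j)) i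
    rw [hr', hs'] at e
    simp only [sub_div, Finset.sum_sub_distrib, eval_sub]
    linear_combination e

/-- The degree budget behind `writeThresh`: null-shaper, unpacker, query and write noise together
exhaust the `X` noise coefficients of the storage. -/
theorem card_add_le_X (t : ℕ) :
    (p.Sw t).card + (p.Rw t - 1) + p.T + p.XΔ ≤ p.X := by
  have h := p.card_Sw_lt t
  unfold Params.Rw Params.SwThresh
  unfold writeThresh at *
  omega

/-- The update adds to the storage a code word that encodes the increment. -/
theorem exists_update_noise (t : ℕ) (θ : Fin K) (d : Fin (p.L ξ) → F) (z : UserNoise p F K ξ t) :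
    ∃ κ : StorageNoise p F K ξ, ∀ n j k,
      ∑ i, nullShaper c t n i j * unpacker c t n i j * writeQuery c t n d z.2 (p.blockW t j) i
          * readQuery c n θ z.1 j i k
        = acsaStorage c n (fun k' => if k' = θ then d else 0) κ j k := by
  let B : Fin (p.J ξ) → Finset (Fin (p.J ξ)) := fun j =>
    Finset.univ.filter fun j' => p.blockW t j' = p.blockW t j ∧ j' ≠ j
  -- Null-shaper times unpacker times query: the indicator of `k = θ` at the pole of row `j`, and
  -- zero at the other poles of its block in column `i`.
  let N : Fin (p.J ξ) → Fin K → Fin p.Kc → F[X] := fun j k i =>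
    C ((∏ m ∈ p.Sw t, (pole c j i - c.α m))⁻¹ * (∏ j' ∈ B j, (pole c j i - pole c j' i))⁻¹) *
      (∏ m ∈ p.Sw t, (X - C (c.α m))) * (∏ j' ∈ B j, (X - C (pole c j' i)))
      * queryPoly c θ z.1 j i k
  have hN : ∀ j k i n, (N j k i).eval (c.α n)
      = nullShaper c t n i j * unpacker c t n i j * readQuery c n θ z.1 j i k := by
    intro j k i n
    simp only [N, B, eval_mul, eval_prod, eval_sub, eval_X, eval_C, eval_queryPoly, nullShaper,
      unpacker]
    ring
  have hself : ∀ j k i, (N j k i).eval (pole c j i) = if k = θ then 1 else 0 := by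
    intro j k i
    simp only [N, eval_mul, eval_prod, eval_sub, eval_X, eval_C, eval_pole_queryPoly]
    have h1 : ∏ m ∈ p.Sw t, (pole c j i - c.α m) ≠ 0 :=
      Finset.prod_ne_zero_iff.2 fun m _ => sub_ne_zero.2 (α_ne_pole c m j i).symm
    have h2 : ∏ j' ∈ B j, (pole c j i - pole c j' i) ≠ 0 := by
      refine Finset.prod_ne_zero_iff.2 fun j' hj' => sub_ne_zero.2 fun e => ?_
      have hj' := (Finset.mem_filter.1 hj').2
      exact hj'.2 (eq_of_pole_eq_of_blockW_eq c hj'.1 e.symm)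
    field_simp
  have hother : ∀ j k i j', p.blockW t j' = p.blockW t j → j' ≠ j →
      (N j k i).eval (pole c j' i) = 0 := by
    intro j k i j' hj' hne
    simp only [N, eval_mul, eval_prod, eval_sub, eval_X, eval_C]
    rw [Finset.prod_eq_zero (i := j') (s := B j) (f := fun x => pole c j' i - pole c x i)
      (by simp [B, hj', hne]) (sub_self _)]
    ring
  have hdeg : ∀ j k i, (N j k i).natDegree ≤ (p.Sw t).card + (p.Rw t - 1) + p.T := by
    intro j k i
    refine natDegree_mul_le_of_le (natDegree_mul_le_of_le ?_ ?_) (natDegree_queryPoly_le c θ _ j i k)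
    · exact (natDegree_C_mul_le _ _).trans (natDegree_prod_X_sub_C_le _ _)
    · exact (natDegree_prod_X_sub_C_le _ _).trans (card_blockW_erase_le t j)
  choose r hr hr' using fun j k i => exists_mul_simple_fractions (hdeg j k i)
    (degree_coeffPoly_lt fun x => z.2 (p.blockW t j) i x)
    (Finset.univ.filter fun j' => p.blockW t j' = p.blockW t j) (fun j' => pole c j' i)
    (fun j' => entry d j' i)
  have hX : ∀ j k i, (r j k i).degree < p.X := fun j k i =>
    (hr j k i).trans_le (by exact_mod_cast card_add_le_X t)
  -- The noise consists of the coefficients of the polynomial parts, summed over `i`; it is the same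
  -- for all servers.
  choose κ hκ using fun j k => exists_coeff_of_degree_lt
    (degree_sum_lt' (s := Finset.univ) fun i _ => hX j k i)
  refine ⟨fun j x k => κ j k x, fun n j k => ?_⟩
  rw [acsaStorage, ← hκ j k, eval_finsetSum, ← Finset.sum_add_distrib]
  refine Finset.sum_congr rfl fun i _ => ?_
  have h := hr' j k i (c.α n) fun j' _ => α_ne_pole c n j' i
  rw [hN, eval_coeffPoly, Finset.sum_eq_single (s := Finset.univ.filter _)
    (f := fun j' => entry d j' i * eval (pole c j' i) (N j k i) / (c.α n - pole c j' i)) j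
    (fun j' hj' hne => by rw [hother j k i j' (Finset.mem_filter.1 hj').2 hne]; simp)
    (by simp), hself] at h
  have hP : writeQuery c t n d z.2 (p.blockW t j) i
      = ∑ j' with p.blockW t j' = p.blockW t j, entry d j' i / (c.α n - pole c j' i)
        + ∑ x : Fin p.XΔ, c.α n ^ (x : ℕ) * z.2 (p.blockW t j) i x := by
    simp only [writeQuery, div_eq_inv_mul, mul_one]
  rw [hP, mul_right_comm, h]
  split_ifs with hk <;> simp [entry_zero, div_eq_inv_mul]

/-- The null-shaper contains the factor `α n - α n`, so a server that misses the update still holds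
its part of the new code word. -/
theorem updateStorage_of_mem {t : ℕ} {n : Fin p.N} (hn : n ∈ p.Sw t) (S : Storage p F K ξ)
    (w : WriteQuery p F ξ t) (Q : ReadQuery p F K ξ) : updateStorage c t n S w Q = S := by
  funext j k
  have h : ∀ i, nullShaper c t n i j = 0 := fun i => by
    rw [nullShaper, Finset.prod_eq_zero hn (sub_self _), zero_div]
  simp [updateStorage, h]

/-! ### Masking by interpolation -/

/-- The read noise can be shifted so that at `T` servers the queries do not depend on the index. -/
theorem exists_readQuery_shift (s : Finset (Fin p.N)) (hs : s.card ≤ p.T) :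
    ∃ δ : Fin K → ReadNoise p F K, ∀ θ z, ∀ n ∈ s, ∀ (j : Fin (p.J ξ)) i k,
      readQuery c n θ z j i k
        = (c.α n - pole c j i) * ∑ x : Fin p.T, c.α n ^ (x : ℕ) * (z + δ θ) (p.row j) i x k := by
  -- The noise enters multiplied by `α n` minus the pole, so the indicator is divided by that factor
  -- before interpolation.
  choose δ hδ using fun (θ : Fin K) (u : Fin p.mu) (i : Fin p.Kc) (k : Fin K) =>
    exists_coeff_interpolate c.α_injective s hs
      fun n => (if k = θ then 1 else 0) / (c.α n - c.ft (p.poleIdx u i))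
  refine ⟨fun θ u i x k => δ θ u i k x, fun θ z n hn j i k => ?_⟩
  have hne : c.α n - pole c j i ≠ 0 := sub_ne_zero.2 (α_ne_pole c n j i)
  simp only [Pi.add_apply, mul_add, Finset.sum_add_distrib, hδ θ _ _ _ n hn, readQuery]
  rw [mul_div_assoc', ← pole, mul_div_cancel_left₀ _ hne, add_comm]

/-- The write noise can be shifted so that at `XΔ` servers the queries do not depend on the
increment. -/
theorem exists_writeQuery_shift (t : ℕ) (s : Finset (Fin p.N)) (hs : s.card ≤ p.XΔ) :
    ∃ δ : (Fin (p.L ξ) → F) → WriteNoise p F ξ t, ∀ d z, ∀ n ∈ s,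
      writeQuery c t n d z = writeQuery c t n 0 (z + δ d) := by
  choose δ hδ using fun (d : Fin (p.L ξ) → F) (l : Fin (p.numW ξ t)) (i : Fin p.Kc) =>
    exists_coeff_interpolate c.α_injective s hs
      fun n => ∑ j with p.blockW t j = l, 1 / (c.α n - pole c j i) * entry d j i
  refine ⟨δ, fun d z n hn => ?_⟩
  funext l i
  simp only [writeQuery, Pi.add_apply, mul_add, Finset.sum_add_distrib, hδ d l i n hn]
  simp [entry_zero, add_comm]

/-- The storage noise can be shifted so that at `X` servers the storage does not depend on the
submodels. -/
theorem exists_acsaStorage_shift (s : Finset (Fin p.N)) (hs : s.card ≤ p.X) :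
    ∃ δ : Submodels p F K ξ → StorageNoise p F K ξ, ∀ W Z, ∀ n ∈ s,
      acsaStorage c n W Z = acsaStorage c n 0 (Z + δ W) := by
  choose δ hδ using fun (W : Submodels p F K ξ) (j : Fin (p.J ξ)) (k : Fin K) =>
    exists_coeff_interpolate c.α_injective s hs
      fun n => ∑ i, 1 / (c.α n - pole c j i) * entry (W k) j i
  refine ⟨fun W j x k => δ W j k x, fun W Z n hn => ?_⟩
  funext j k
  simp only [acsaStorage, Pi.add_apply, mul_add, Finset.sum_add_distrib, hδ W j k n hn]
  simp [entry_zero, add_comm]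

/-- Every content of a server is the noiseless code of some submodels. -/
theorem acsaStorage_surjective (n : Fin p.N) :
    Function.Surjective fun W : Submodels p F K ξ => acsaStorage c n W 0 := by
  intro S
  let i₀ : Fin p.Kc := ⟨0, p.Kc_pos⟩
  -- A single column suffices: its entries are scaled to cancel the Cauchy factor and all others are
  -- zero.
  refine ⟨fun k m => if (finProdFinEquiv.symm m).2 = i₀ then
    (c.α n - pole c (finProdFinEquiv.symm m).1 i₀) * S (finProdFinEquiv.symm m).1 k else 0, ?_⟩
  funext j k
  have hne : c.α n - pole c j i₀ ≠ 0 := sub_ne_zero.2 (α_ne_pole c n j i₀)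
  simp [acsaStorage, entry, hne]

end SchemeAlgebra

end ACSA

namespace ACSA

open MeasureTheory ProbabilityTheory

set_option synthInstance.maxSize 1000

namespace Model

variable {p : Params} {F : Type*} [MeasurableSpace F] {K ξ : ℕ}
  {Ω : Type*} [MeasurableSpace Ω] {P : Measure Ω} (M : Model p F K ξ P) (c : Constants p F)

/-! ### The first `m` users -/

/-- The indices of the first `m` users. -/
def idxs (m : ℕ) (ω : Ω) : Fin m → Fin K := fun τ => M.idx τ ω

/-- The increments of the first `m` users. -/
def incs (m : ℕ) (ω : Ω) : Fin m → Fin (p.L ξ) → F := fun τ => M.inc τ ω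

/-- The noise of the first `m` users. -/
def noises (m : ℕ) (ω : Ω) : (τ : Fin m) → UserNoise p F K ξ τ := fun τ => M.ZU τ ω

theorem measurable_idxs (m : ℕ) : Measurable (M.idxs m) :=
  measurable_pi_lambda _ fun τ => (M.unif_idx τ).1

theorem measurable_incs (m : ℕ) : Measurable (M.incs m) :=
  measurable_pi_lambda _ fun τ => (M.unif_inc τ).1

theorem measurable_noises (m : ℕ) : Measurable (M.noises m) :=
  measurable_pi_lambda _ fun τ => (M.unif_ZU τ).1

theorem indepFun_storage_noise (m : ℕ) :
    IndepFun M.ZS (fun ω => (M.noises m ω, M.W0 ω, M.incs m ω, M.idxs m ω)) P := by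
  refine M.indep₁.comp (φ := id) (ψ := fun x =>
    ((fun τ : Fin m => x.1 τ), x.2.1, (fun τ : Fin m => x.2.2.1 τ), (fun τ : Fin m => x.2.2.2 τ)))
    measurable_id ?_
  fun_prop

theorem indepFun_noises (m : ℕ) :
    IndepFun (M.noises m) (fun ω => (M.W0 ω, M.incs m ω, M.idxs m ω)) P := by
  refine M.indep₂.comp (φ := fun x => (fun τ : Fin m => x τ)) (ψ := fun x =>
    (x.1, (fun τ : Fin m => x.2.1 τ), (fun τ : Fin m => x.2.2 τ))) ?_ ?_ <;> fun_prop

theorem indepFun_W0 (m : ℕ) : IndepFun M.W0 (fun ω => (M.incs m ω, M.idxs m ω)) P := by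
  refine M.indep₃.comp (φ := id) (ψ := fun x =>
    ((fun τ : Fin m => x.1 τ), (fun τ : Fin m => x.2 τ))) measurable_id ?_
  fun_prop

theorem indepFun_incs_idxs (m : ℕ) : IndepFun (M.incs m) (M.idxs m) P := by
  refine M.indep₄.comp (φ := fun x => (fun τ : Fin m => x τ))
    (ψ := fun x => (fun τ : Fin m => x τ)) ?_ ?_ <;> fun_prop

section Finite

variable [Fintype F] [MeasurableSingletonClass F] [IsProbabilityMeasure P]

theorem isUniform_noises (m : ℕ) : IsUniform (M.noises m) P :=
  IsUniform.pi (fun τ : Fin m => M.unif_ZU τ) (M.indep_ZU.precomp Fin.val_injective)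

theorem indepFun_noises_all (m : ℕ) :
    IndepFun (M.noises m) (fun ω => (M.ZS ω, M.W0 ω, M.incs m ω, M.idxs m ω)) P :=
  indepFun_prod_rotate M.unif_ZS.1 (M.measurable_noises m)
    (M.unif_W0.1.prodMk ((M.measurable_incs m).prodMk (M.measurable_idxs m)))
    (M.indepFun_storage_noise m) (M.indepFun_noises m)

variable [Field F]

/-- User noise that is masked by the indices reveals nothing about them. -/
theorem indepFun_idxs_masked (m : ℕ) {U : Ω → (τ : Fin m) → UserNoise p F K ξ τ}
    (hU : ∀ ω ω', M.idxs m ω = M.idxs m ω' → U ω - M.noises m ω = U ω' - M.noises m ω') :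
    Measurable U ∧ IndepFun (M.idxs m) (fun ω => (U ω, M.ZS ω, M.W0 ω, M.incs m ω)) P := by
  have m1 := M.measurable_idxs m
  have m2 := M.measurable_incs m
  have m3 := M.unif_W0.1
  have m4 := M.unif_ZS.1
  have h1 : IndepFun (M.idxs m) (fun ω => (M.W0 ω, M.incs m ω)) P :=
    indepFun_prod_rotate m3 m1 m2 ((M.indepFun_W0 m).comp measurable_id measurable_swap)
      (M.indepFun_incs_idxs m).symm
  have h2 : IndepFun (M.idxs m) (fun ω => (M.ZS ω, M.W0 ω, M.incs m ω)) P :=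
    indepFun_prod_rotate m4 m1 (m3.prodMk m2)
      (indepFun_of_factor (M.indepFun_storage_noise m) (by simp +contextual)) h1
  -- The masked noise is independent of all the other variables including the indices; a last
  -- rotation isolates the indices.
  have h3 := (M.isUniform_noises m).shift (U' := U) (m1.prodMk (m4.prodMk (m3.prodMk m2)))
    (indepFun_of_factor (M.indepFun_noises_all m) (by simp +contextual))
    fun ω ω' h => hU ω ω' (Prod.ext_iff.1 h).1
  exact ⟨h3.1.1, indepFun_prod_rotate h3.1.1 m1 (m4.prodMk (m3.prodMk m2)) h3.2 h2⟩

/-- User noise that is masked by the increments reveals nothing about them. -/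
theorem indepFun_incs_masked (m : ℕ) {U : Ω → (τ : Fin m) → UserNoise p F K ξ τ}
    (hU : ∀ ω ω', M.incs m ω = M.incs m ω' → U ω - M.noises m ω = U ω' - M.noises m ω') :
    Measurable U ∧ IndepFun (M.incs m) (fun ω => (U ω, M.ZS ω, M.W0 ω, M.idxs m ω)) P := by
  have m1 := M.measurable_incs m
  have m2 := M.measurable_idxs m
  have m3 := M.unif_W0.1
  have m4 := M.unif_ZS.1
  have h1 : IndepFun (M.incs m) (fun ω => (M.W0 ω, M.idxs m ω)) P :=
    indepFun_prod_rotate m3 m1 m2 (M.indepFun_W0 m) (M.indepFun_incs_idxs m)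
  have h2 : IndepFun (M.incs m) (fun ω => (M.ZS ω, M.W0 ω, M.idxs m ω)) P :=
    indepFun_prod_rotate m4 m1 (m3.prodMk m2)
      (indepFun_of_factor (M.indepFun_storage_noise m) (by simp +contextual)) h1
  have h3 := (M.isUniform_noises m).shift (U' := U) (m1.prodMk (m4.prodMk (m3.prodMk m2)))
    (indepFun_of_factor (M.indepFun_noises_all m) (by simp +contextual))
    fun ω ω' h => hU ω ω' (Prod.ext_iff.1 h).1
  exact ⟨h3.1.1, indepFun_prod_rotate h3.1.1 m1 (m4.prodMk (m3.prodMk m2)) h3.2 h2⟩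

end Finite

variable [Field F]

/-! ### The storage over time -/

/-- The noise in the storage after the first `t` updates. -/
noncomputable def storageNoise : ℕ → Ω → StorageNoise p F K ξ
  | 0, ω => M.ZS ω
  | t + 1, ω => storageNoise t ω
      + (exists_update_noise c t (M.idx t ω) (M.inc t ω) (M.ZU t ω)).choose

theorem S_succ (t : ℕ) (n : Fin p.N) (ω : Ω) :
    M.S c (t + 1) n ω = updateStorage c t n (M.S c t n ω)
      (writeQuery c t n (M.inc t ω) (M.ZU t ω).2) (M.Q c t n ω) := by
  by_cases hn : n ∈ p.Sw t
  · simp [S, PW, hn, updateStorage_of_mem]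
  · simp [S, PW, hn]

/-- Each update adds a code word of the increment, and encoding is additive in submodels and noise.
-/
theorem S_eq_acsaStorage (t : ℕ) (n : Fin p.N) (ω : Ω) :
    M.S c t n ω = acsaStorage c n (M.W t ω) (M.storageNoise c t ω) := by
  induction t with
  | zero => rfl
  | succ t ih =>
    have hW : M.W (t + 1) ω = M.W t ω + fun k => if k = M.idx t ω then M.inc t ω else 0 := by
      funext k
      simp only [W, Pi.add_apply]
      split_ifs <;> simp
    rw [S_succ, hW, storageNoise, acsaStorage_add, ← ih]
    funext j k
    rw [Pi.add_apply, Pi.add_apply, ← (exists_update_noise c t (M.idx t ω) (M.inc t ω)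
      (M.ZU t ω)).choose_spec n j k]
    rfl

/-- The difference is a function of increments and indices, in the form that `IsUniform.shift`
requires. -/
theorem W_sub_W0 (t : ℕ) {ω ω' : Ω} (h₁ : M.incs t ω = M.incs t ω')
    (h₂ : M.idxs t ω = M.idxs t ω') : M.W t ω - M.W0 ω = M.W t ω' - M.W0 ω' := by
  induction t with
  | zero => simp [W]
  | succ t ih =>
    have e₁ : M.inc t ω = M.inc t ω' := congrFun h₁ (Fin.last t)
    have e₂ : M.idx t ω = M.idx t ω' := congrFun h₂ (Fin.last t)
    have h := ih (funext fun τ => congrFun h₁ τ.castSucc) (funext fun τ => congrFun h₂ τ.castSucc)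
    funext k
    have hk := congrFun h k
    simp only [W, Pi.sub_apply, e₁, e₂] at hk ⊢
    split_ifs
    · rw [add_sub_right_comm, hk, add_sub_right_comm]
    · exact hk

theorem storageNoise_sub_ZS (t : ℕ) {ω ω' : Ω} (h₁ : M.incs t ω = M.incs t ω')
    (h₂ : M.idxs t ω = M.idxs t ω') (h₃ : M.noises t ω = M.noises t ω') :
    M.storageNoise c t ω - M.ZS ω = M.storageNoise c t ω' - M.ZS ω' := by
  induction t with
  | zero => simp [storageNoise]
  | succ t ih =>
    have e₁ : M.inc t ω = M.inc t ω' := congrFun h₁ (Fin.last t)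
    have e₂ : M.idx t ω = M.idx t ω' := congrFun h₂ (Fin.last t)
    have e₃ : M.ZU t ω = M.ZU t ω' := congrFun h₃ (Fin.last t)
    have h := ih (funext fun τ => congrFun h₁ τ.castSucc) (funext fun τ => congrFun h₂ τ.castSucc)
      (funext fun τ => congrFun h₃ τ.castSucc)
    simp only [storageNoise, e₁, e₂, e₃]
    rw [add_sub_right_comm, h, add_sub_right_comm]

/-- The storage history in a coalition's view is determined by the initial storage and the queries
received. -/
theorem S_congr (t : ℕ) (n : Fin p.N) {ω ω' : Ω} (h0 : M.S c 0 n ω = M.S c 0 n ω')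
    (hP : ∀ τ < t, M.PW c τ n ω = M.PW c τ n ω') (hQ : ∀ τ < t, M.Q c τ n ω = M.Q c τ n ω') :
    M.S c t n ω = M.S c t n ω' := by
  induction t with
  | zero => exact h0
  | succ t ih =>
    have h := ih (fun τ hτ => hP τ (hτ.trans t.lt_succ_self))
      (fun τ hτ => hQ τ (hτ.trans t.lt_succ_self))
    simp only [S, hP t t.lt_succ_self, hQ t t.lt_succ_self, h]

theorem S_succ_of_mem (t : ℕ) {n : Fin p.N} (hn : n ∈ p.Sw t) : M.S c (t + 1) n = M.S c t n := by
  funext ω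
  rw [S_succ, updateStorage_of_mem c hn]

/-! ### Correctness, security and privacy. -/

section Finite

variable [Fintype F]

theorem correct (t : ℕ) : M.Correct c t := by
  refine condEntropy_eq_zero _ fun ω ω' h => ?_
  simp only [Prod.mk.injEq] at h
  obtain ⟨hA, -, hi⟩ := h
  rw [← hi]
  refine eq_of_answer_eq c t (Z := M.storageNoise c t ω) (Z' := M.storageNoise c t ω')
    (z := (M.ZU t ω).1) (z' := (M.ZU t ω').1) fun n hn => ?_
  have h := congrFun hA ⟨n, hn⟩
  simp only [A, S_eq_acsaStorage, Q, ← hi] at h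
  exact h

variable [MeasurableSingletonClass F] [IsProbabilityMeasure P]

theorem isUniform_W (t : ℕ) : IsUniform (M.W t) P :=
  (M.unif_W0.shift ((M.measurable_incs t).prodMk (M.measurable_idxs t)) (M.indepFun_W0 t)
    fun _ _ h => M.W_sub_W0 t (Prod.ext_iff.1 h).1 (Prod.ext_iff.1 h).2).1

/-- `ZS` acts as a pad against user noise, initial submodels, increments and indices, and these
determine `W t`. -/
theorem isUniform_storageNoise (t : ℕ) :
    IsUniform (M.storageNoise c t) P ∧ IndepFun (M.storageNoise c t) (M.W t) P := by
  have hm : Measurable fun ω => (M.noises t ω, M.W0 ω, M.incs t ω, M.idxs t ω) :=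
    (M.measurable_noises t).prodMk
      (M.unif_W0.1.prodMk ((M.measurable_incs t).prodMk (M.measurable_idxs t)))
  refine (M.unif_ZS.shift (U' := M.storageNoise c t) hm (M.indepFun_storage_noise t)
    fun ω ω' h => ?_).imp_right fun h => ?_
  · simp only [Prod.mk.injEq] at h
    exact M.storageNoise_sub_ZS c t h.2.2.1 h.2.2.2 h.1
  · refine indepFun_of_factor h fun ω ω' h => ?_
    simp only [Prod.mk.injEq] at h
    have := M.W_sub_W0 t h.2.2.1 h.2.2.2
    rw [h.2.1] at this
    exact sub_left_injective this

theorem structurePreserved (t : ℕ) : M.StructurePreserved c t :=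
  ⟨M.storageNoise c t, (M.isUniform_storageNoise c t).1, (M.isUniform_storageNoise c t).2,
    fun n ω => M.S_eq_acsaStorage c t n ω⟩

theorem storageSecure (t : ℕ) (s : Finset (Fin p.N)) (hs : s.card ≤ p.X) :
    M.StorageSecure c t s := by
  obtain ⟨δ, hδ⟩ := exists_acsaStorage_shift (K := K) (ξ := ξ) c s hs
  have hZ := M.isUniform_storageNoise c t
  have hU := hZ.1.shift (U' := fun ω => M.storageNoise c t ω + δ (M.W t ω)) (M.isUniform_W t).1 hZ.2
    fun ω ω' h => by simp [h]
  refine mutualInfo_eq_zero _ (M.isUniform_W t).1 hU.1.1 hU.2.symm fun ω ω' h => ?_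
  funext n
  rw [S_eq_acsaStorage, S_eq_acsaStorage, hδ (M.W t ω) _ n n.2, hδ (M.W t ω') _ n n.2, h]

/-- The uniform submodels alone suffice: the code word of the noise is pulled back through a right
inverse of the encoding to a shift of `W t`. -/
theorem isUniform_S (t : ℕ) (n : Fin p.N) : IsUniform (M.S c t n) P := by
  let φ : Submodels p F K ξ →+ Storage p F K ξ := AddMonoidHom.mk'
    (fun W => acsaStorage c n W 0) fun W W' => by
      rw [← acsaStorage_add, add_zero]
  have hφ : Function.Surjective φ := acsaStorage_surjective c n
  obtain ⟨e, he⟩ := hφ.hasRightInverse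
  have hZ := M.isUniform_storageNoise c t
  have hU := ((M.isUniform_W t).shift
    (U' := fun ω => M.W t ω + e (acsaStorage c n 0 (M.storageNoise c t ω))) hZ.1.1 hZ.2.symm
    fun ω ω' h => by simp [h]).1
  have hS : M.S c t n
      = fun ω => φ (M.W t ω + e (acsaStorage c n 0 (M.storageNoise c t ω))) := by
    funext ω
    rw [map_add, he, S_eq_acsaStorage]
    change _ = acsaStorage c n (M.W t ω) 0 + _
    rw [← acsaStorage_add, add_zero, zero_add]
  rw [hS]
  exact hU.map_addHom φ hφ

/-- The coalition's whole view is a function of masked read noise, write noise, storage noise,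
initial submodels and increments, jointly independent of the indices. -/
theorem isPrivate (t : ℕ) (s : Finset (Fin p.N)) (hs : s.card ≤ p.T) : M.Private c t s := by
  obtain ⟨δ, hδ⟩ := exists_readQuery_shift (K := K) (ξ := ξ) c s hs
  obtain ⟨hm, hi⟩ := M.indepFun_idxs_masked (t + 1)
    (U := fun ω τ => ((M.ZU τ ω).1 + δ (M.idx τ ω), (M.ZU τ ω).2)) fun ω ω' h => by
      funext τ
      have e : M.idx τ ω = M.idx τ ω' := congrFun h τ
      simp [noises, e, Prod.ext_iff]
  have key : ∀ ω ω', ((fun τ : Fin (t + 1) => ((M.ZU τ ω).1 + δ (M.idx τ ω), (M.ZU τ ω).2)),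
      M.ZS ω, M.W0 ω, M.incs (t + 1) ω) = ((fun τ : Fin (t + 1) =>
        ((M.ZU τ ω').1 + δ (M.idx τ ω'), (M.ZU τ ω').2)), M.ZS ω', M.W0 ω', M.incs (t + 1) ω') →
      ∀ n ∈ s, M.S c 0 n ω = M.S c 0 n ω' ∧ ∀ τ ≤ t, M.Q c τ n ω = M.Q c τ n ω' ∧
        M.PW c τ n ω = M.PW c τ n ω' := by
    intro ω ω' h n hn
    simp only [Prod.mk.injEq] at h
    obtain ⟨hU, hZ, hW, hd⟩ := h
    refine ⟨by simp only [S, hZ, hW], fun τ hτ => ?_⟩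
    have e1 := congrFun hU ⟨τ, Nat.lt_succ_of_le hτ⟩
    have e2 : M.inc τ ω = M.inc τ ω' := congrFun hd ⟨τ, Nat.lt_succ_of_le hτ⟩
    simp only [Prod.mk.injEq] at e1
    refine ⟨?_, by simp only [PW, e1.2, e2]⟩
    funext j i k
    rw [Q, Q, hδ _ _ n hn, hδ _ _ n hn, e1.1]
  refine condMutualInfo_eq_zero _ (M.measurable_idxs (t + 1)) (hm.prodMk
    (M.unif_ZS.1.prodMk (M.unif_W0.1.prodMk (M.measurable_incs (t + 1))))) hi
    (fun ω ω' h => ?_) fun ω ω' h => ?_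
  · funext n
    have := (key ω ω' h n n.2).2 t le_rfl
    rw [this.1, this.2]
  · have hk := key ω ω' h
    refine Prod.ext ?_ (Prod.ext ?_ ?_)
    · funext τ n
      refine M.S_congr c τ n (hk n n.2).1 (fun σ hσ => ?_) fun σ hσ => ?_
      · exact ((hk n n.2).2 σ (hσ.le.trans (Nat.le_of_lt_succ τ.2))).2
      · exact ((hk n n.2).2 σ (hσ.le.trans (Nat.le_of_lt_succ τ.2))).1
    · funext τ n
      exact ((hk n n.2).2 τ τ.2.le).2
    · funext τ n
      exact ((hk n n.2).2 τ τ.2.le).1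

/-- The same with the roles exchanged: the write noise absorbs the increments, and the indices may
be revealed. -/
theorem updateSecure (t : ℕ) (s : Finset (Fin p.N)) (hs : s.card ≤ p.XΔ) :
    M.UpdateSecure c t s := by
  choose δ hδ using fun τ => exists_writeQuery_shift (ξ := ξ) c τ s hs
  obtain ⟨hm, hi⟩ := M.indepFun_incs_masked (t + 1)
    (U := fun ω τ => ((M.ZU τ ω).1, (M.ZU τ ω).2 + δ τ (M.inc τ ω))) fun ω ω' h => by
      funext τ
      have e : M.inc τ ω = M.inc τ ω' := congrFun h τ
      simp [noises, e, Prod.ext_iff]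
  have key : ∀ ω ω', ((fun τ : Fin (t + 1) => ((M.ZU τ ω).1, (M.ZU τ ω).2 + δ τ (M.inc τ ω))),
      M.ZS ω, M.W0 ω, M.idxs (t + 1) ω) = ((fun τ : Fin (t + 1) =>
        ((M.ZU τ ω').1, (M.ZU τ ω').2 + δ τ (M.inc τ ω'))), M.ZS ω', M.W0 ω',
          M.idxs (t + 1) ω') →
      ∀ n ∈ s, M.S c 0 n ω = M.S c 0 n ω' ∧ ∀ τ ≤ t, M.Q c τ n ω = M.Q c τ n ω' ∧
        M.PW c τ n ω = M.PW c τ n ω' := by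
    intro ω ω' h n hn
    simp only [Prod.mk.injEq] at h
    obtain ⟨hU, hZ, hW, hd⟩ := h
    refine ⟨by simp only [S, hZ, hW], fun τ hτ => ?_⟩
    have e1 := congrFun hU ⟨τ, Nat.lt_succ_of_le hτ⟩
    have e2 : M.idx τ ω = M.idx τ ω' := congrFun hd ⟨τ, Nat.lt_succ_of_le hτ⟩
    simp only [Prod.mk.injEq] at e1
    refine ⟨by simp only [Q, e1.1, e2], ?_⟩
    rw [PW, PW, hδ τ (M.inc τ ω) _ n hn, hδ τ (M.inc τ ω') _ n hn, e1.2]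
  refine condMutualInfo_eq_zero _ (M.measurable_incs (t + 1)) (hm.prodMk
    (M.unif_ZS.1.prodMk (M.unif_W0.1.prodMk (M.measurable_idxs (t + 1))))) hi
    (fun ω ω' h => ?_) fun ω ω' h => ?_
  · funext n
    exact ((key ω ω' h n n.2).2 t le_rfl).2
  · have hk := key ω ω' h
    refine Prod.ext ?_ ?_
    · funext τ n
      refine Prod.ext (M.S_congr c τ n (hk n n.2).1 (fun σ hσ => ?_) fun σ hσ => ?_) ?_
      · exact ((hk n n.2).2 σ (hσ.le.trans (Nat.le_of_lt_succ τ.2))).2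
      · exact ((hk n n.2).2 σ (hσ.le.trans (Nat.le_of_lt_succ τ.2))).1
      · exact ((hk n n.2).2 τ (Nat.le_of_lt_succ τ.2)).1
    · funext τ n
      exact ((hk n n.2).2 τ τ.2.le).2

end Finite

end Model

end ACSA

namespace ACSA

open MeasureTheory ProbabilityTheory

/-! ### Costs and efficiency -/

section Sizes

variable (p : Params) (F : Type*) [Fintype F]

theorem nonempty_constants (h : p.N + max p.mu p.Kc ≤ Fintype.card F) :
    Nonempty (Constants p F) := by
  obtain ⟨e⟩ := Function.Embedding.nonempty_of_card_le
    (α := Fin p.N ⊕ Fin (max p.mu p.Kc)) (β := F) (by simpa using h)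
  refine ⟨⟨fun n => e (Sum.inl n), fun m => e (Sum.inr m), ?_⟩⟩
  convert e.injective
  funext x
  cases x <;> rfl

theorem Params.J_pos {ξ : ℕ} (hξ : 0 < ξ) : 0 < p.J ξ := by
  refine Nat.mul_pos hξ (Nat.pos_of_ne_zero fun h => ?_)
  obtain ⟨x, hx, h0⟩ := Finset.lcm_eq_zero_iff.1 h
  simp only [Finset.mem_union, Finset.mem_Icc, id] at hx h0
  omega

theorem Params.cast_Rr (t : ℕ) : (p.Rr t : ℝ) = p.SrThresh - (p.Sr t).card :=
  Nat.cast_sub (p.card_Sr_lt t).le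

theorem Params.cast_Rw (t : ℕ) : (p.Rw t : ℝ) = p.SwThresh - (p.Sw t).card :=
  Nat.cast_sub (p.card_Sw_lt t).le

theorem Params.cast_numR (ξ t : ℕ) : (p.numR ξ t : ℝ) = p.J ξ / p.Rr t :=
  Nat.cast_div (p.Rr_dvd_J ξ t) (by exact_mod_cast (p.Rr_pos t).ne')

theorem Params.cast_numW (ξ t : ℕ) : (p.numW ξ t : ℝ) = p.J ξ / p.Rw t :=
  Nat.cast_div (p.Rw_dvd_J ξ t) (by exact_mod_cast (p.Rw_pos t).ne')

theorem Params.cast_card_compl (s : Finset (Fin p.N)) : ((sᶜ.card : ℕ) : ℝ) = p.N - s.card := by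
  rw [Finset.card_compl, Fintype.card_fin, Nat.cast_sub (by simpa using s.card_le_univ)]

theorem symbolCount_eq [Nontrivial F] {α : Type*} [Fintype α] {m : ℕ}
    (h : Fintype.card α = Fintype.card F ^ m) : symbolCount (Fintype.card F) α = m := by
  have h1 : 1 < Fintype.card F := Fintype.one_lt_card
  rw [symbolCount, h, Nat.cast_pow, Real.logb_pow, Real.logb_self_eq_one (by exact_mod_cast h1),
    mul_one]

theorem downloadCost_eq [Nontrivial F] {ξ : ℕ} (hξ : 0 < ξ) (t : ℕ) :
    downloadCost p F ξ t
      = ((p.N : ℝ) - (p.Sr t).card) / ((p.SrThresh : ℝ) - (p.Sr t).card) := by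
  have h : symbolCount (Fintype.card F) (Answer p F ξ t) = (p.Kc * p.numR ξ t : ℕ) :=
    symbolCount_eq F (by simp [Answer, pow_mul])
  have hJ : (p.J ξ : ℝ) ≠ 0 := by exact_mod_cast (p.J_pos hξ).ne'
  have hK : (p.Kc : ℝ) ≠ 0 := by exact_mod_cast p.Kc_pos.ne'
  have hR : (p.Rr t : ℝ) ≠ 0 := by exact_mod_cast (p.Rr_pos t).ne'
  rw [downloadCost, h, Finset.sum_const, nsmul_eq_mul, p.cast_card_compl, ← p.cast_Rr, Params.L]
  push_cast
  rw [p.cast_numR]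
  field_simp

/-- A read message has `mu * Kc * K` symbols whatever `ξ` is, so its share decays like `K / L`; the
write share is exact. -/
theorem uploadCost_eq [Nontrivial F] {K ξ : ℕ} (hξ : 0 < ξ) (t : ℕ) :
    uploadCost p F K ξ t = ((p.Sr t ∩ p.Sw t)ᶜ.card * (p.mu * p.Kc) : ℝ) * ((p.L ξ : ℝ) / K)⁻¹
      + ((p.N : ℝ) - (p.Sw t).card) / ((p.SwThresh : ℝ) - (p.Sw t).card) := by
  have h : symbolCount (Fintype.card F) (WriteQuery p F ξ t) = (p.Kc * p.numW ξ t : ℕ) :=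
    symbolCount_eq F (by simp [WriteQuery, pow_mul])
  have h' : symbolCount (Fintype.card F) (ReadMessage p F K) = (K * p.Kc * p.mu : ℕ) :=
    symbolCount_eq F (by simp [ReadMessage, pow_mul])
  have hJ : (p.J ξ : ℝ) ≠ 0 := by exact_mod_cast (p.J_pos hξ).ne'
  have hK : (p.Kc : ℝ) ≠ 0 := by exact_mod_cast p.Kc_pos.ne'
  have hR : (p.Rw t : ℝ) ≠ 0 := by exact_mod_cast (p.Rw_pos t).ne'
  rw [uploadCost, h, h', Finset.sum_const, Finset.sum_const, nsmul_eq_mul, nsmul_eq_mul,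
    p.cast_card_compl (p.Sw t), ← p.cast_Rw, Params.L]
  push_cast
  rw [p.cast_numW]
  field_simp

theorem tendsto_uploadCost [Nontrivial F] (t : ℕ) :
    Filter.Tendsto (fun s : ℕ+ × ℕ+ => uploadCost p F s.1 s.2 t)
      (Filter.comap (fun s : ℕ+ × ℕ+ => (p.L s.2 : ℝ) / (s.1 : ℕ)) Filter.atTop)
      (nhds (((p.N : ℝ) - (p.Sw t).card) / ((p.SwThresh : ℝ) - (p.Sw t).card))) := by
  simp only [fun s : ℕ+ × ℕ+ => uploadCost_eq p F (K := s.1) s.2.pos t]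
  have h := ((tendsto_inv_atTop_zero (𝕜 := ℝ)).comp (Filter.tendsto_comap
    (f := fun s : ℕ+ × ℕ+ => (p.L s.2 : ℝ) / (s.1 : ℕ)))).const_mul
    ((p.Sr t ∩ p.Sw t)ᶜ.card * (p.mu * p.Kc) : ℝ)
  have h2 := h.add_const (((p.N : ℝ) - (p.Sw t).card) / ((p.SwThresh : ℝ) - (p.Sw t).card))
  rw [mul_zero, zero_add] at h2
  exact h2

end Sizes

theorem Model.efficiency_eq {p : Params} {F : Type*} [Field F] [Fintype F] [MeasurableSpace F]
    [MeasurableSingletonClass F] {K ξ : ℕ} (hK : 0 < K) (hξ : 0 < ξ) {Ω : Type*}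
    [MeasurableSpace Ω] {P : Measure Ω} [IsProbabilityMeasure P] (M : Model p F K ξ P)
    (c : Constants p F) (t : ℕ) : M.efficiency c t = (p.Kc : ℝ) / p.N := by
  have hs : ∀ n, entropy (Fintype.card F) P (M.S c t n) = (K * p.J ξ : ℕ) := fun n => by
    rw [(M.isUniform_S c t n).entropy_eq]
    exact symbolCount_eq F (α := Storage p F K ξ) (by simp [Storage, pow_mul])
  have hJ : (p.J ξ : ℝ) ≠ 0 := by exact_mod_cast (p.J_pos hξ).ne'
  have hK' : (K : ℝ) ≠ 0 := by exact_mod_cast hK.ne'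
  simp only [efficiency, hs, Finset.sum_const, Finset.card_univ, Fintype.card_fin, nsmul_eq_mul,
    Params.L]
  push_cast
  -- For `N = 0`, which the thresholds in fact exclude, both sides are a division by zero.
  by_cases hN : (p.N : ℝ) = 0
  · simp [hN]
  · field_simp

end ACSA

theorem theorem1 (p : ACSA.Params) (F : Type*) [Field F] [Fintype F] [MeasurableSpace F]
    [MeasurableSingletonClass F]
    (hq : p.N + max (max p.SrThresh p.SwThresh) p.Kc ≤ Fintype.card F) :
    -- the constants that the scheme needs exist
    Nonempty (ACSA.Constants p F) ∧
    -- download cost, exactly and for all sizes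
    (∀ (ξ : ℕ+) (t : ℕ), ACSA.downloadCost p F ξ t =
      ((p.N : ℝ) - (p.Sr t).card) / ((p.SrThresh : ℝ) - (p.Sr t).card)) ∧
    -- upload cost, in the limit L / K → ∞
    (∀ t : ℕ, Filter.Tendsto (fun s : ℕ+ × ℕ+ => ACSA.uploadCost p F s.1 s.2 t)
      (Filter.comap (fun s : ℕ+ × ℕ+ => (p.L s.2 : ℝ) / (s.1 : ℕ)) Filter.atTop)
      (nhds (((p.N : ℝ) - (p.Sw t).card) / ((p.SwThresh : ℝ) - (p.Sw t).card)))) ∧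
    -- for every choice of the constants and of the sizes, at every time
    ∀ (c : ACSA.Constants p F) (K ξ : ℕ+) (Ω : Type*) [MeasurableSpace Ω]
      (P : MeasureTheory.Measure Ω) [MeasureTheory.IsProbabilityMeasure P]
      (M : ACSA.Model p F K ξ P) (t : ℕ),
      -- the symbols sent determine the read query
      (∀ n ω j i k, M.Q c t n ω j i k =
        ACSA.readMessage c n (M.idx t ω) (M.ZU t ω).1 (p.row j) i k) ∧
      M.Correct c t ∧
      (∀ 𝒯 : Finset (Fin p.N), 𝒯.card ≤ p.T → M.Private c t 𝒯) ∧
      (∀ 𝒳 : Finset (Fin p.N), 𝒳.card ≤ p.XΔ → M.UpdateSecure c t 𝒳) ∧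
      (∀ 𝒳 : Finset (Fin p.N), 𝒳.card ≤ p.X → M.StorageSecure c t 𝒳) ∧
      M.StructurePreserved c t ∧
      (∀ n ∈ p.Sw t, M.S c (t + 1) n = M.S c t n) ∧
      M.efficiency c t = (p.Kc : ℝ) / p.N := by
  refine ⟨ACSA.nonempty_constants p F hq, fun ξ t => ACSA.downloadCost_eq p F ξ.pos t,
    ACSA.tendsto_uploadCost p F, fun c K ξ Ω _ P _ M t => ⟨fun _ _ _ _ _ => rfl, M.correct c t,
      M.isPrivate c t, M.updateSecure c t, M.storageSecure c t, M.structurePreserved c t,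
      fun _ => M.S_succ_of_mem c t, M.efficiency_eq K.pos ξ.pos c t⟩⟩
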